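/- Let $A=(a_{i,j})\in\mathbb{Z}^{d\times n}$ be an integer matrix with columns $a_1,\dots,a_n$. Let $\mathbb{N}A\subseteq\mathbb{Z}^d$ be the semigroup generated by the columns. Assume that $\mathbb{N}A$ is positive (that is, $0$ is its only invertible element), that the columns generate $\mathbb{Z}^d$ as a group, and that the semigroup ring $S_A=\mathbb{C}[\mathbb{N}A]=\bigoplus_{h\in\mathbb{N}A}\mathbb{C}\,t^h$ is Cohen--Macaulay. Let $D_A$ be the complex Weyl algebra in $x_1,\dots,x_n$, with $\partial_j=\partial/\partial x_j$, and let $R_A=\mathbb{C}[\partial_1,\dots,\partial_n]\subseteq D_A$ act on $S_A$ by $\partial_j\cdot t^h=t^{h+a_j}$. Put $E_i=\sum_{j=1}^n a_{i,j}x_j\partial_j$ for $i=1,\dots,d$. For $\beta\in\mathbb{C}^d$, let the Euler--Koszul complex $K_\bullet(S_A,\beta)$ be the Koszul complex of the $d$ commuting endomorphisms of the left $D_A$-module $D_A\otimes_{R_A}S_A$ given by $$P\otimes t^h\longmapsto P\,(E_i-\beta_i+h_i)\otimes t^h\qquad(P\in D_A,\ h\in\mathbb{N}A),\quad i=1,\dots,d.$$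 (This is $E_i-\beta_i-\deg_i$ for the $\mathbb{Z}^d$-grading of $S_A$ with $\deg\partial_j=-a_j$, i.e. $\deg t^h=-h$.) Then, for every $\beta\in\mathbb{C}^d$, the complex $K_\bullet(S_A,\beta)$ is acyclic in the sense of a resolution: $H_p(K_\bullet(S_A,\beta))=0$ for all $p>0$. -/

import Mathlib

open scoped TensorProduct

/-! ### Cohen–Macaulay rings -/

/-- A local ring is Cohen–Macaulay if it is Noetherian and its maximal ideal contains a regular
sequence whose length is the Krull dimension, that is, if depth equals dimension. -/
def IsCohenMacaulayLocalRing (R : Type*) [CommRing R] [IsLocalRing R] : Prop :=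
  IsNoetherianRing R ∧
    ∃ rs : List R, (∀ r ∈ rs, r ∈ IsLocalRing.maximalIdeal R) ∧
      RingTheory.Sequence.IsRegular R rs ∧ (rs.length : WithBot ℕ∞) = ringKrullDim R

/-- A commutative ring is Cohen–Macaulay if it is Noetherian and all its local rings are
Cohen–Macaulay. -/
def IsCohenMacaulayRing (R : Type*) [CommRing R] : Prop :=
  IsNoetherianRing R ∧
    ∀ (p : Ideal R) [p.IsPrime], IsCohenMacaulayLocalRing (Localization.AtPrime p)

/-! ### The Koszul complex of commuting endomorphisms -/

namespace Koszul

variable {D : Type} [Ring D] {M : Type} [AddCommGroup M] [Module D M] {d : ℕ}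

/-- The degree `p` term `⨁_{|I| = p} M e_I`; the sum is over the `p`-element subsets
of `{0, …, d - 1}`. -/
abbrev Term (M : Type) (d p : ℕ) : Type := {I : Finset (Fin d) // I.card = p} → M

/-- The Koszul differential
`m e_{i_0 < ⋯ < i_p} ↦ ∑_k (-1)^k φ_{i_k}(m) e_{i_0, …, i_{k-1}, i_{k+1}, …, i_p}`,
written coefficientwise: the coefficient at `e_T` receives a contribution from `e_{T ∪ {i}}`
for each `i ∉ T`, and its sign is the parity of the number of elements of `T` below `i`. -/
def differential (φ : Fin d → Module.End D M) (p : ℕ) : Term M d (p + 1) →ₗ[D] Term M d p :=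
  LinearMap.pi fun T => ∑ i : Fin d,
    if h : i ∈ T.1 then 0
    else ((-1 : ℤ) ^ (T.1.filter (· < i)).card) •
      ((φ i).comp (LinearMap.proj (⟨insert i T.1, by
        rw [Finset.card_insert_of_notMem h, T.2]⟩ : {I : Finset (Fin d) // I.card = p + 1})))

theorem differential_apply (φ : Fin d → Module.End D M) (p : ℕ) (g : Term M d (p + 1))
    (T : {I : Finset (Fin d) // I.card = p}) :
    differential φ p g T = ∑ i : Fin d,
      if h : i ∈ T.1 then 0
      else ((-1 : ℤ) ^ (T.1.filter (· < i)).card) •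
        φ i (g ⟨insert i T.1, by rw [Finset.card_insert_of_notMem h, T.2]⟩) := by
  simp only [differential, LinearMap.pi_apply, LinearMap.sum_apply]
  refine Finset.sum_congr rfl fun i _ => ?_
  split_ifs <;> simp

theorem sign_swap (T : Finset (Fin d)) (i j : Fin d) (hi : i ∉ T) (hj : j ∉ T) (hij : i ≠ j) :
    (-1 : ℤ) ^ (T.filter (· < i)).card * (-1 : ℤ) ^ ((insert i T).filter (· < j)).card +
      (-1 : ℤ) ^ (T.filter (· < j)).card * (-1 : ℤ) ^ ((insert j T).filter (· < i)).card = 0 := by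
  rcases lt_or_gt_of_ne hij with h | h
  · rw [Finset.filter_insert, Finset.filter_insert, if_pos h, if_neg h.not_gt,
      Finset.card_insert_of_notMem (by simp [hi])]
    ring
  · rw [Finset.filter_insert, Finset.filter_insert, if_pos h, if_neg h.not_gt,
      Finset.card_insert_of_notMem (by simp [hj])]
    ring

theorem differential_comp (φ : Fin d → Module.End D M) (hφ : ∀ i j, Commute (φ i) (φ j))
    (p : ℕ) : (differential φ p).comp (differential φ (p + 1)) = 0 := by
  refine LinearMap.ext fun g => funext fun T => ?_
  have hcomm : ∀ i j m, φ i (φ j m) = φ j (φ i m) := fun i j m =>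
    LinearMap.congr_fun (hφ i j).eq m
  have key : differential φ p (differential φ (p + 1) g) T =
      ∑ x : Fin d × Fin d,
        if h : x.1 ∉ T.1 ∧ x.2 ∉ T.1 ∧ x.1 ≠ x.2 then
          ((-1 : ℤ) ^ (T.1.filter (· < x.1)).card *
            (-1 : ℤ) ^ ((insert x.1 T.1).filter (· < x.2)).card) •
              φ x.1 (φ x.2 (g ⟨insert x.2 (insert x.1 T.1), by
                rw [Finset.card_insert_of_notMem, Finset.card_insert_of_notMem h.1, T.2]
                simp [h.2.1, Ne.symm h.2.2]⟩))
        else 0 := by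
    rw [differential_apply, Fintype.sum_prod_type]
    refine Finset.sum_congr rfl fun i _ => ?_
    by_cases hi : i ∈ T.1
    · simp [hi]
    · rw [dif_neg hi, differential_apply, map_sum, Finset.smul_sum]
      refine Finset.sum_congr rfl fun j _ => ?_
      by_cases hj : j ∈ insert i T.1
      · rw [dif_pos hj, dif_neg]
        · simp
        · simp only [Finset.mem_insert] at hj
          rintro ⟨_, h2, h3⟩
          rcases hj with hj | hj
          · exact h3 hj.symm
          · exact h2 hj
      · have hj' := hj
        simp only [Finset.mem_insert, not_or] at hj'
        rw [dif_neg hj, dif_pos ⟨hi, hj'.2, Ne.symm hj'.1⟩, map_zsmul, smul_smul]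
  rw [LinearMap.comp_apply, key]
  refine Finset.sum_involution (fun x _ => (x.2, x.1)) ?_ ?_ ?_ ?_
  · rintro ⟨i, j⟩ _
    by_cases h : i ∉ T.1 ∧ j ∉ T.1 ∧ i ≠ j
    · rw [dif_pos h, dif_pos ⟨h.2.1, h.1, h.2.2.symm⟩]
      simp only [hcomm j i, Finset.insert_comm i j T.1]
      rw [← add_smul, sign_swap T.1 i j h.1 h.2.1 h.2.2, zero_smul]
    · rw [dif_neg h, dif_neg fun h' => h ⟨h'.2.1, h'.1, h'.2.2.symm⟩, add_zero]
  · rintro ⟨i, j⟩ _ hne heq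
    apply hne
    rw [dif_neg]
    rintro ⟨_, _, h⟩
    exact h (congrArg Prod.snd heq)
  · intro x _
    exact Finset.mem_univ _
  · intro x _
    rfl

/-- The Koszul complex of the pairwise commuting endomorphisms `φ_0, …, φ_{d-1}` of the left
module `M`, in homological degrees `0, …, d`. -/
noncomputable def complex (φ : Fin d → Module.End D M) (hφ : ∀ i j, Commute (φ i) (φ j)) :
    ChainComplex (ModuleCat.{0} D) ℕ :=
  ChainComplex.of (fun p => ModuleCat.of D (Term M d p))
    (fun p => ModuleCat.ofHom (differential φ p))
    (fun p => by
      rw [← ModuleCat.ofHom_comp, differential_comp φ hφ p]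
      rfl)

end Koszul

/-! ### The Weyl algebra -/

/-- The complex Weyl algebra in `x_0, …, x_{n-1}`: the algebra of operators on
`ℂ[x_0, …, x_{n-1}]` generated by the multiplications by the variables and by the partial
derivatives. -/
def WeylAlgebra (n : ℕ) : Type :=
  Algebra.adjoin ℂ
    (Set.range (fun j : Fin n => LinearMap.mulLeft ℂ (MvPolynomial.X j : MvPolynomial (Fin n) ℂ)) ∪
      Set.range (fun j : Fin n => (MvPolynomial.pderiv (R := ℂ) j :
        MvPolynomial (Fin n) ℂ →ₗ[ℂ] MvPolynomial (Fin n) ℂ)) :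
      Set (Module.End ℂ (MvPolynomial (Fin n) ℂ)))

namespace WeylAlgebra

variable {n : ℕ}

noncomputable instance : Ring (WeylAlgebra n) := inferInstanceAs (Ring (Algebra.adjoin ℂ _))

noncomputable instance : Algebra ℂ (WeylAlgebra n) :=
  inferInstanceAs (Algebra ℂ (Algebra.adjoin ℂ _))

/-- The inclusion of the Weyl algebra into the operators on polynomials. -/
noncomputable def val : WeylAlgebra n →ₐ[ℂ] Module.End ℂ (MvPolynomial (Fin n) ℂ) :=
  Subalgebra.val (Algebra.adjoin ℂ _)

theorem val_injective : Function.Injective (val (n := n)) := Subtype.val_injective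

/-- The variable `x_j`. -/
noncomputable def x (j : Fin n) : WeylAlgebra n :=
  ⟨LinearMap.mulLeft ℂ (MvPolynomial.X j), Algebra.subset_adjoin (Or.inl ⟨j, rfl⟩)⟩

/-- The derivation `∂_j = ∂/∂x_j`. -/
noncomputable def der (j : Fin n) : WeylAlgebra n :=
  ⟨(MvPolynomial.pderiv j).toLinearMap, Algebra.subset_adjoin (Or.inr ⟨j, rfl⟩)⟩

theorem val_x (j : Fin n) (f : MvPolynomial (Fin n) ℂ) : val (x j) f = MvPolynomial.X j * f := rfl

theorem val_der (j : Fin n) (f : MvPolynomial (Fin n) ℂ) :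
    val (der j) f = MvPolynomial.pderiv j f := rfl

theorem der_comm (i j : Fin n) : der i * der j = der j * der i := by
  apply val_injective
  rw [map_mul, map_mul]
  have h : ⁅MvPolynomial.pderiv (R := ℂ) i, MvPolynomial.pderiv (R := ℂ) j⁆ = 0 := by
    apply MvPolynomial.derivation_ext
    intro k
    rw [Derivation.commutator_apply, MvPolynomial.pderiv_X, MvPolynomial.pderiv_X]
    simp [Pi.single_apply, apply_ite]
  refine LinearMap.ext fun f => ?_
  have := congrArg (fun δ => δ f) h
  simp only [Derivation.commutator_apply, Derivation.coe_zero, Pi.zero_apply] at this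
  exact sub_eq_zero.mp this

theorem x_comm (i j : Fin n) : x i * x j = x j * x i := by
  apply val_injective
  refine LinearMap.ext fun f => ?_
  simp only [map_mul, Module.End.mul_apply, val_x]
  ring

theorem der_mul_x (i j : Fin n) : der i * x j = x j * der i + if i = j then 1 else 0 := by
  apply val_injective
  refine LinearMap.ext fun f => ?_
  rw [map_mul, map_add, map_mul, LinearMap.add_apply, Module.End.mul_apply, Module.End.mul_apply,
    val_x, val_der, val_der, val_x, Derivation.leibniz, MvPolynomial.pderiv_X]
  by_cases h : i = j
  · subst h
    simp
  · simp [h, Ne.symm h]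

/-- The polynomial ring `ℂ[∂_0, …, ∂_{n-1}]`; its variable `MvPolynomial.X j` stands for `∂_j`. -/
abbrev OpRing (n : ℕ) : Type := MvPolynomial (Fin n) ℂ

open scoped IsMulCommutative in
/-- The inclusion `ℂ[∂] → D` with `X j ↦ ∂_j`. -/
noncomputable def ofOp : OpRing n →ₐ[ℂ] WeylAlgebra n :=
  haveI : IsMulCommutative (Algebra.adjoin ℂ (Set.range (der (n := n)))) :=
    Algebra.isMulCommutative_adjoin ℂ (by
      rintro _ ⟨i, rfl⟩ _ ⟨j, rfl⟩
      exact der_comm i j)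
  (Subalgebra.val (Algebra.adjoin ℂ (Set.range (der (n := n))))).comp
    (MvPolynomial.aeval fun j => ⟨der j, Algebra.subset_adjoin ⟨j, rfl⟩⟩)

theorem ofOp_X (j : Fin n) : ofOp (MvPolynomial.X j) = der j := by
  simp [ofOp]

/-- The Weyl algebra as a module over `ℂ[∂]` by multiplication on the right. -/
noncomputable instance : Module (OpRing n) (WeylAlgebra n) where
  smul r P := P * ofOp r
  one_smul P := show P * ofOp 1 = P by rw [map_one, mul_one]
  mul_smul r s P := show P * ofOp (r * s) = P * ofOp s * ofOp r by
    rw [mul_comm r s, map_mul, mul_assoc]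
  smul_zero r := zero_mul (ofOp r)
  smul_add r P Q := add_mul P Q (ofOp r)
  add_smul r s P := show P * ofOp (r + s) = P * ofOp r + P * ofOp s by rw [map_add, mul_add]
  zero_smul P := show P * ofOp 0 = 0 by rw [map_zero, mul_zero]

theorem op_smul_def (r : OpRing n) (P : WeylAlgebra n) : r • P = P * ofOp r := rfl

instance : SMulCommClass (OpRing n) (WeylAlgebra n) (WeylAlgebra n) where
  smul_comm r P Q := mul_assoc P Q (ofOp r)

end WeylAlgebra

/-! ### Toric rings and the Euler–Koszul complex -/

namespace EulerKoszul

variable {d n : ℕ} (A : Matrix (Fin d) (Fin n) ℤ)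

/-- The semigroup `ℕA` generated by the columns of `A`. -/
def semigroup : AddSubmonoid (Fin d → ℤ) := AddSubmonoid.closure (Set.range fun j i => A i j)

/-- The `j`-th column of `A` as an element of `ℕA`. -/
def col (j : Fin n) : semigroup A :=
  ⟨fun i => A i j, AddSubmonoid.subset_closure ⟨j, rfl⟩⟩

/-- The toric ring `S_A = ℂ[ℕA]`. -/
def ToricRing : Type := AddMonoidAlgebra ℂ (semigroup A)

noncomputable instance : CommRing (ToricRing A) :=
  inferInstanceAs (CommRing (AddMonoidAlgebra ℂ (semigroup A)))

noncomputable instance : Algebra ℂ (ToricRing A) :=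
  inferInstanceAs (Algebra ℂ (AddMonoidAlgebra ℂ (semigroup A)))

/-- The basis of `S_A` that consists of the monomials. -/
noncomputable def monomialBasis : Module.Basis (semigroup A) ℂ (ToricRing A) :=
  AddMonoidAlgebra.basis (semigroup A) ℂ

/-- The monomial `t^h`, for `h ∈ ℕA`. -/
noncomputable def monomial (h : semigroup A) : ToricRing A :=
  AddMonoidAlgebra.single h (1 : ℂ)

theorem monomialBasis_apply (h : semigroup A) : monomialBasis A h = monomial A h := rfl

theorem monomial_mul (h k : semigroup A) :
    monomial A h * monomial A k = monomial A (h + k) := by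
  refine (AddMonoidAlgebra.single_mul_single h k (1 : ℂ) 1).trans ?_
  rw [mul_one]
  rfl

/-- `S_A` as an algebra over `ℂ[∂]`, with `∂_j ↦ t^{a_j}`. -/
noncomputable instance : Algebra (WeylAlgebra.OpRing n) (ToricRing A) :=
  (MvPolynomial.aeval (R := ℂ) fun j => monomial A (col A j)).toRingHom.toAlgebra

theorem X_smul (j : Fin n) (y : ToricRing A) :
    (MvPolynomial.X j : WeylAlgebra.OpRing n) • y = monomial A (col A j) * y := by
  rw [Algebra.smul_def]
  congr 1
  exact MvPolynomial.aeval_X _ j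

theorem C_smul (c : ℂ) (y : ToricRing A) :
    (MvPolynomial.C c : WeylAlgebra.OpRing n) • y = c • y := by
  rw [Algebra.smul_def, Algebra.smul_def]
  congr 1
  exact MvPolynomial.aeval_C _ c

/-- The `ℂ`-linear map `t^h ↦ h_i t^h` on `S_A`. -/
noncomputable def weight (i : Fin d) : ToricRing A →ₗ[ℂ] ToricRing A :=
  (monomialBasis A).constr ℂ fun h => h.1 i • monomial A h

theorem weight_monomial (i : Fin d) (h : semigroup A) :
    weight A i (monomial A h) = h.1 i • monomial A h := by
  rw [← monomialBasis_apply, weight, Module.Basis.constr_basis, monomialBasis_apply]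

theorem weight_comm (i k : Fin d) (y : ToricRing A) :
    weight A i (weight A k y) = weight A k (weight A i y) := by
  have : weight A i ∘ₗ weight A k = weight A k ∘ₗ weight A i := by
    refine (monomialBasis A).ext fun h => ?_
    simp only [LinearMap.comp_apply, monomialBasis_apply, weight_monomial, map_zsmul]
    exact smul_comm _ _ _
  exact LinearMap.congr_fun this y

theorem weight_X_smul (i : Fin d) (j : Fin n) (y : ToricRing A) :
    weight A i ((MvPolynomial.X j : WeylAlgebra.OpRing n) • y) =
      A i j • ((MvPolynomial.X j : WeylAlgebra.OpRing n) • y) +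
        (MvPolynomial.X j : WeylAlgebra.OpRing n) • weight A i y := by
  rw [X_smul, X_smul]
  have : weight A i ∘ₗ LinearMap.mulLeft ℂ (monomial A (col A j)) =
      A i j • LinearMap.mulLeft ℂ (monomial A (col A j)) +
        LinearMap.mulLeft ℂ (monomial A (col A j)) ∘ₗ weight A i := by
    refine (monomialBasis A).ext fun h => ?_
    simp only [LinearMap.comp_apply, monomialBasis_apply, weight_monomial, LinearMap.add_apply,
      LinearMap.smul_apply, LinearMap.mulLeft_apply, mul_smul_comm, monomial_mul]
    rw [← add_smul]
    rfl
  exact LinearMap.congr_fun this y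

/-- The operator `E_i - β_i ∈ D_A`, where `E_i = ∑_j a_{i,j} x_j ∂_j`. -/
noncomputable def euler (β : Fin d → ℂ) (i : Fin d) : WeylAlgebra n :=
  (∑ j : Fin n, A i j • (WeylAlgebra.x j * WeylAlgebra.der j)) - algebraMap ℂ _ (β i)

theorem theta_comm (j k : Fin n) :
    Commute (WeylAlgebra.x j * WeylAlgebra.der j) (WeylAlgebra.x k * WeylAlgebra.der k) := by
  by_cases h : j = k
  · rw [h]
  · have h1 : Commute (WeylAlgebra.der j) (WeylAlgebra.x k) := by
      have := WeylAlgebra.der_mul_x j k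
      rwa [if_neg h, add_zero] at this
    have h2 : Commute (WeylAlgebra.der k) (WeylAlgebra.x j) := by
      have := WeylAlgebra.der_mul_x k j
      rwa [if_neg (Ne.symm h), add_zero] at this
    have h3 : Commute (WeylAlgebra.x j) (WeylAlgebra.x k) := WeylAlgebra.x_comm j k
    have h4 : Commute (WeylAlgebra.der j) (WeylAlgebra.der k) := WeylAlgebra.der_comm j k
    exact (h3.mul_right h2.symm).mul_left (h1.mul_right h4)

theorem euler_comm (β : Fin d → ℂ) (i k : Fin d) : Commute (euler A β i) (euler A β k) := by
  have h : Commute (∑ j : Fin n, A i j • (WeylAlgebra.x j * WeylAlgebra.der j))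
      (∑ j : Fin n, A k j • (WeylAlgebra.x j * WeylAlgebra.der j)) :=
    Commute.sum_left _ _ _ fun j _ => Commute.sum_right _ _ _ fun l _ =>
      ((theta_comm j l).smul_left _).smul_right _
  exact (h.sub_right (Algebra.commute_algebraMap_right _ _)).sub_left
    (Algebra.commute_algebraMap_left _ _)

theorem der_mul_euler (β : Fin d → ℂ) (i : Fin d) (j : Fin n) :
    WeylAlgebra.der j * euler A β i = euler A β i * WeylAlgebra.der j +
      A i j • WeylAlgebra.der j := by
  have key : ∀ k : Fin n, WeylAlgebra.der j * (WeylAlgebra.x k * WeylAlgebra.der k) =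
      (WeylAlgebra.x k * WeylAlgebra.der k) * WeylAlgebra.der j +
        if j = k then WeylAlgebra.der k else 0 := fun k => by
    rw [← mul_assoc, WeylAlgebra.der_mul_x, add_mul, mul_assoc, WeylAlgebra.der_comm j k,
      ← mul_assoc]
    split_ifs <;> simp
  rw [euler, mul_sub, sub_mul, Algebra.commutes, Finset.mul_sum, Finset.sum_mul]
  simp only [mul_smul_comm, smul_mul_assoc, key, smul_add, Finset.sum_add_distrib, smul_ite,
    smul_zero, Finset.sum_ite_eq, Finset.mem_univ, if_true]
  abel

/-- The left `D_A`-module `D_A ⊗_{ℂ[∂]} S_A`. -/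
abbrev Mod : Type := WeylAlgebra n ⊗[WeylAlgebra.OpRing n] ToricRing A

/-- The additive map `P ⊗ y ↦ P (E_i - β_i) ⊗ y + P ⊗ θ_i y`, where `θ_i t^h = h_i t^h`. -/
noncomputable def eulerAddHom (β : Fin d → ℂ) (i : Fin d) : Mod A →+ Mod A :=
  TensorProduct.liftAddHom
    (AddMonoidHom.mk' (fun P => AddMonoidHom.mk'
        (fun y => (P * euler A β i) ⊗ₜ[WeylAlgebra.OpRing n] y +
          P ⊗ₜ[WeylAlgebra.OpRing n] weight A i y)
        (fun y z => by
          rw [map_add, TensorProduct.tmul_add, TensorProduct.tmul_add]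
          abel))
      (fun P Q => by
        ext y
        simp only [AddMonoidHom.mk'_apply, AddMonoidHom.add_apply, add_mul, TensorProduct.add_tmul]
        abel))
    (fun r => by
      simp only [AddMonoidHom.mk'_apply]
      induction r using MvPolynomial.induction_on with
      | C c =>
        intro P y
        have h : (MvPolynomial.C c : WeylAlgebra.OpRing n) • P * euler A β i =
            (MvPolynomial.C c : WeylAlgebra.OpRing n) • (P * euler A β i) := by
          have e : WeylAlgebra.ofOp (MvPolynomial.C c : WeylAlgebra.OpRing n) =
            algebraMap ℂ _ c := WeylAlgebra.ofOp.commutes c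
          rw [WeylAlgebra.op_smul_def, WeylAlgebra.op_smul_def, e, mul_assoc, mul_assoc,
            Algebra.commutes]
        rw [h, C_smul A c, map_smul, ← C_smul, ← C_smul, TensorProduct.smul_tmul,
          TensorProduct.smul_tmul]
      | add p q hp hq =>
        intro P y
        rw [add_smul, add_smul, add_mul, TensorProduct.add_tmul, TensorProduct.add_tmul, map_add,
          TensorProduct.tmul_add, TensorProduct.tmul_add, add_add_add_comm, hp, hq,
          add_add_add_comm]
      | mul_X p j hp =>
        intro P y
        rw [mul_smul, hp, mul_comm p, mul_smul]
        generalize p • y = z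
        rw [weight_X_smul, WeylAlgebra.op_smul_def, WeylAlgebra.ofOp_X, mul_assoc, der_mul_euler,
          mul_add, ← mul_assoc, mul_smul_comm, TensorProduct.add_tmul, TensorProduct.tmul_add,
          ← WeylAlgebra.ofOp_X, ← WeylAlgebra.op_smul_def, ← WeylAlgebra.op_smul_def,
          TensorProduct.smul_tmul, TensorProduct.tmul_smul, ← TensorProduct.smul_tmul',
          TensorProduct.smul_tmul, TensorProduct.smul_tmul, add_assoc,
          TensorProduct.tmul_smul (A i j)])

theorem eulerAddHom_tmul (β : Fin d → ℂ) (i : Fin d) (P : WeylAlgebra n) (y : ToricRing A) :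
    eulerAddHom A β i (P ⊗ₜ y) = (P * euler A β i) ⊗ₜ y + P ⊗ₜ weight A i y := rfl

/-- The endomorphism `E_i - β_i` of the left `D_A`-module `D_A ⊗_{ℂ[∂]} S_A`. -/
noncomputable def eulerEnd (β : Fin d → ℂ) (i : Fin d) : Module.End (WeylAlgebra n) (Mod A) where
  toFun := eulerAddHom A β i
  map_add' := map_add _
  map_smul' Q z := by
    rw [RingHom.id_apply]
    induction z using TensorProduct.induction_on with
    | zero => simp
    | add z w hz hw => rw [smul_add, map_add, hz, hw, map_add, smul_add]
    | tmul P y =>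
      rw [TensorProduct.smul_tmul', eulerAddHom_tmul, eulerAddHom_tmul, smul_add,
        TensorProduct.smul_tmul', TensorProduct.smul_tmul', smul_eq_mul, smul_eq_mul, mul_assoc]

theorem eulerEnd_tmul (β : Fin d → ℂ) (i : Fin d) (P : WeylAlgebra n) (y : ToricRing A) :
    eulerEnd A β i (P ⊗ₜ y) = (P * euler A β i) ⊗ₜ y + P ⊗ₜ weight A i y := rfl

/-- The defining formula `P ⊗ t^h ↦ P (E_i - β_i - deg_i(t^h)) ⊗ t^h`, for the grading with
`deg ∂_j = -a_j`, so that `deg t^h = -h`. -/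
theorem eulerEnd_tmul_monomial (β : Fin d → ℂ) (i : Fin d) (P : WeylAlgebra n)
    (h : semigroup A) :
    eulerEnd A β i (P ⊗ₜ monomial A h) =
      (P * (euler A β i - algebraMap ℂ _ ((-h.1 i : ℤ) : ℂ))) ⊗ₜ monomial A h := by
  rw [eulerEnd_tmul, weight_monomial, TensorProduct.tmul_smul, TensorProduct.smul_tmul',
    ← TensorProduct.add_tmul, map_intCast, Int.cast_neg, sub_neg_eq_add, mul_add, zsmul_eq_mul,
    Int.cast_comm]

theorem eulerEnd_comm (β : Fin d → ℂ) (i k : Fin d) :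
    Commute (eulerEnd A β i) (eulerEnd A β k) := by
  refine LinearMap.ext fun z => ?_
  rw [Module.End.mul_apply, Module.End.mul_apply]
  induction z using TensorProduct.induction_on with
  | zero => simp
  | add z w hz hw => simp only [map_add, hz, hw]
  | tmul P y =>
    simp only [eulerEnd_tmul, map_add, mul_assoc, (euler_comm A β i k).eq, weight_comm A i k]
    abel

/-- The Euler–Koszul complex `K_•(S_A, β)`: the Koszul complex of the endomorphisms
`E_0 - β_0, …, E_{d-1} - β_{d-1}` of `D_A ⊗_{ℂ[∂]} S_A`. -/
noncomputable def eulerKoszulComplex (β : Fin d → ℂ) :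
    ChainComplex (ModuleCat.{0} (WeylAlgebra n)) ℕ :=
  Koszul.complex (eulerEnd A β) (eulerEnd_comm A β)

end EulerKoszul

/-!
The operators of `D_A` have unique normal forms `∑_u x ^ u f_u(∂)`, so `D_A ⊗ S_A` is identified
with the polynomial ring `S_A[x]` as an additive group (`WeylAlgebra.xPowBasis`,
`EulerKoszul.polyEquiv`). Under this identification the endomorphism `E_i - β_i` becomes
multiplication by the symbol `∑_j a_{i,j} t^{a_j} x_j`, which raises the degree in `x` by one, plus
a map that preserves the degree. Subtracting boundaries from the top component downwards shows that
the Euler–Koszul complex is exact in positive degrees as soon as the Koszul complex of the symbols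
on `S_A[x]` is (`Koszul.ExactAtSucc.add_of_graded`, `EulerKoszul.exactAtSucc_eulerEnd`). The
parameter `β` plays no further role.

Exactness for the symbols is checked at the primes `P` of `S_A`, by induction on `P`: after
localization the homology is supported at `P`, hence torsion with respect to the elements of `P`,
and the ideal of the symbols annihilates it. By the acyclicity lemma
(`Koszul.exactAtSucc_of_isWeaklyRegular`) it vanishes if these elements contain a weakly regular
sequence of length `d` (`Koszul.exactAtSucc_mvPolynomial`). Let `r` be the rank of the columns `a_j`
with `t^{a_j} ∉ P`. Suitable combinations of the symbols are `r` linear forms in echelon form with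
invertible pivots `t^{a_j}`, and they remain regular after any regular sequence of the coefficient
ring (`isWeaklyRegular_map_C_append_linearForms`). The Cohen–Macaulay property supplies a regular
sequence in `P` of length the height of `P`.

It remains to see that this height is at least `d - r` (`EulerKoszul.le_height_add_card`). The
columns span `ℚ^d`, so `S_A` has transcendence degree at least `d`. Modulo `P`, each monomial
`t^{a_k} ∉ P` is algebraic over those of `r` independent columns, so `S_A / P` has transcendence
degree at most `r`. For affine domains such as `S_A` the height of a prime is at least the drop in
transcendence degree; this follows from Noether normalization and going down
(`heightAddTrdegGE_of_finiteType`).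
-/

/-! ### Koszul complexes of commuting endomorphisms -/

namespace Koszul

variable {D : Type} [Ring D] {M : Type} [AddCommGroup M] [Module D M] {d : ℕ}

/-- Exactness of the Koszul complex at its term of degree `q + 1`. -/
def ExactAtSucc (φ : Fin d → Module.End D M) (q : ℕ) : Prop :=
  ∀ z : Term M d (q + 1), differential φ q z = 0 → ∃ w, differential φ (q + 1) w = z

theorem exactAt_complex {φ : Fin d → Module.End D M} (hφ : ∀ i j, Commute (φ i) (φ j)) {q : ℕ}
    (h : ExactAtSucc φ q) : (complex φ hφ).ExactAt (q + 1) := by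
  rw [HomologicalComplex.exactAt_iff' _ (q + 2) (q + 1) q (by simp) (by simp),
    CategoryTheory.ShortComplex.moduleCat_exact_iff]
  intro z hz
  have e1 : (complex φ hφ).d (q + 2) (q + 1) = ModuleCat.ofHom (differential φ (q + 1)) :=
    ChainComplex.of_d (fun p => ModuleCat.of D (Term M d p))
      (fun p => ModuleCat.ofHom (differential φ p)) (q + 1)
  have e2 : (complex φ hφ).d (q + 1) q = ModuleCat.ofHom (differential φ q) :=
    ChainComplex.of_d (fun p => ModuleCat.of D (Term M d p))
      (fun p => ModuleCat.ofHom (differential φ p)) q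
  obtain ⟨w, hw⟩ := h z (by
    have : (complex φ hφ).d (q + 1) q z = 0 := hz
    rwa [e2] at this)
  refine ⟨w, ?_⟩
  change (complex φ hφ).d (q + 2) (q + 1) w = z
  rw [e1]
  exact hw

theorem differential_differential {φ : Fin d → Module.End D M}
    (hφ : ∀ i j, Commute (φ i) (φ j)) (p : ℕ) (z : Term M d (p + 2)) :
    differential φ p (differential φ (p + 1) z) = 0 :=
  LinearMap.congr_fun (differential_comp φ hφ p) z

/-- Additive maps that intertwine two families of endomorphisms intertwine the Koszul
differentials. -/
theorem differential_map {D' : Type} [Ring D'] {M' : Type} [AddCommGroup M'] [Module D' M']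
    {φ : Fin d → Module.End D M} {φ' : Fin d → Module.End D' M'} {f g : M →+ M'}
    (hfg : ∀ i m, g (φ i m) = φ' i (f m)) (p : ℕ) (z : Term M d (p + 1)) :
    differential φ' p (fun I => f (z I)) = fun T => g (differential φ p z T) := by
  funext T
  rw [differential_apply, differential_apply, map_sum]
  refine Finset.sum_congr rfl fun i _ => ?_
  split_ifs
  · rw [map_zero]
  · rw [map_zsmul, hfg]

theorem ExactAtSucc.of_addEquiv {D' : Type} [Ring D'] {M' : Type} [AddCommGroup M'] [Module D' M']
    {φ : Fin d → Module.End D M} {φ' : Fin d → Module.End D' M'} (f : M ≃+ M')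
    (hf : ∀ i m, f (φ i m) = φ' i (f m)) {q : ℕ} (h : ExactAtSucc φ q) : ExactAtSucc φ' q := by
  intro z hz
  have hf' : ∀ i m, f.symm (φ' i m) = φ i (f.symm m) := fun i m => by
    rw [AddEquiv.symm_apply_eq, hf, AddEquiv.apply_symm_apply]
  obtain ⟨w, hw⟩ := h (fun I => f.symm (z I)) ((differential_map (f := f.symm.toAddMonoidHom)
    (g := f.symm.toAddMonoidHom) hf' q z).trans (by
      rw [hz]
      exact funext fun _ => map_zero f.symm))
  refine ⟨fun I => f (w I), (differential_map (f := f.toAddMonoidHom) (g := f.toAddMonoidHom)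
    hf (q + 1) w).trans ?_⟩
  rw [hw]
  exact funext fun I => f.apply_symm_apply (z I)

theorem differential_add (φ ψ : Fin d → Module.End D M) (p : ℕ) (z : Term M d (p + 1)) :
    differential (fun i => φ i + ψ i) p z = differential φ p z + differential ψ p z := by
  funext T
  rw [Pi.add_apply, differential_apply, differential_apply, differential_apply,
    ← Finset.sum_add_distrib]
  refine Finset.sum_congr rfl fun i _ => ?_
  split_ifs
  · rw [add_zero]
  · rw [LinearMap.add_apply, smul_add]

/-- The exterior product with the basis vector `e_i`, as a map between the terms of the Koszul
complex. -/
def wedge (i : Fin d) (p : ℕ) (z : Term M d p) : Term M d (p + 1) := fun T =>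
  if h : i ∈ T.1 then
    ((-1 : ℤ) ^ (T.1.filter (· < i)).card) •
      z ⟨T.1.erase i, by rw [Finset.card_erase_of_mem h, T.2, Nat.add_sub_cancel]⟩
  else 0

theorem card_filter_lt_erase_self (T : Finset (Fin d)) (i : Fin d) :
    ((T.erase i).filter (· < i)).card = (T.filter (· < i)).card := by
  congr 1
  ext j
  simp only [Finset.mem_filter, Finset.mem_erase]
  exact ⟨fun h => ⟨h.1.2, h.2⟩, fun h => ⟨⟨h.2.ne, h.1⟩, h.2⟩⟩

theorem card_filter_lt_insert_self (T : Finset (Fin d)) (i : Fin d) :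
    ((insert i T).filter (· < i)).card = (T.filter (· < i)).card := by
  rw [Finset.filter_insert, if_neg (lt_irrefl i)]

theorem neg_one_pow_mul_self (k : ℕ) : (-1 : ℤ) ^ k * (-1) ^ k = 1 := by
  rw [← mul_pow]
  norm_num

/-- Each of the endomorphisms is homotopic to zero on the Koszul complex; the homotopy is the
exterior product with the corresponding basis vector. -/
theorem differential_wedge (φ : Fin d → Module.End D M) (i : Fin d) (p : ℕ)
    (z : Term M d (p + 1)) (T : {I : Finset (Fin d) // I.card = p + 1}) :
    differential φ (p + 1) (wedge i (p + 1) z) T + wedge i p (differential φ p z) T =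
      φ i (z T) := by
  rw [differential_apply]
  by_cases hi : i ∈ T.1
  · rw [wedge, dif_pos hi, differential_apply, Finset.smul_sum, ← Finset.sum_add_distrib]
    rw [Finset.sum_eq_single i]
    · rw [dif_pos hi, zero_add, dif_neg (Finset.notMem_erase i T.1), smul_smul,
        card_filter_lt_erase_self, neg_one_pow_mul_self, one_smul]
      congr 2
      exact Subtype.ext (Finset.insert_erase hi)
    · intro k _ hk
      by_cases hkT : k ∈ T.1
      · rw [dif_pos hkT, dif_pos (Finset.mem_erase.2 ⟨hk, hkT⟩), smul_zero, zero_add]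
      · have hk' : k ∉ T.1.erase i := fun h => hkT (Finset.mem_of_mem_erase h)
        rw [dif_neg hkT, dif_neg hk', wedge, dif_pos (Finset.mem_insert_of_mem hi), map_zsmul,
          smul_smul, smul_smul]
        have hset : (insert k T.1).erase i = insert k (T.1.erase i) := by
          rw [Finset.erase_insert_of_ne hk]
        have key := sign_swap (T.1.erase i) i k (Finset.notMem_erase i T.1) hk' (Ne.symm hk)
        rw [Finset.insert_erase hi] at key
        have hs : ((insert k T.1).filter (· < i)).card =
            ((insert k (T.1.erase i)).filter (· < i)).card := by
          rw [← hset, card_filter_lt_erase_self]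
        rw [hs, ← card_filter_lt_erase_self T.1 i]
        simp only [hset]
        rw [← add_smul]
        have h0 : (-1 : ℤ) ^ (T.1.filter (· < k)).card *
            (-1 : ℤ) ^ ((insert k (T.1.erase i)).filter (· < i)).card +
            (-1 : ℤ) ^ ((T.1.erase i).filter (· < i)).card *
            (-1 : ℤ) ^ ((T.1.erase i).filter (· < k)).card = 0 := by
          have h1 := neg_one_pow_mul_self (T.1.filter (· < k)).card
          have h2 := neg_one_pow_mul_self ((T.1.erase i).filter (· < k)).card
          generalize (-1 : ℤ) ^ ((T.1.erase i).filter (· < i)).card = a at *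
          generalize (-1 : ℤ) ^ (T.1.filter (· < k)).card = b at *
          generalize (-1 : ℤ) ^ ((T.1.erase i).filter (· < k)).card = c at *
          generalize (-1 : ℤ) ^ ((insert k (T.1.erase i)).filter (· < i)).card = e at *
          linear_combination c * b * key - a * c * h1 - e * b * h2
        rw [h0, zero_smul]
    · simp
  · rw [wedge, dif_neg hi, add_zero, Finset.sum_eq_single i]
    · rw [dif_neg hi, wedge, dif_pos (Finset.mem_insert_self i T.1), map_zsmul, smul_smul,
        card_filter_lt_insert_self, neg_one_pow_mul_self, one_smul]
      congr 2
      exact Subtype.ext (Finset.erase_insert hi)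
    · intro k _ hk
      split_ifs with hkT
      · rfl
      · rw [wedge, dif_neg (by simp [hi, Ne.symm hk]), map_zero, smul_zero]
    · simp

end Koszul

/-! ### The acyclicity lemma -/

namespace Koszul

open scoped Pointwise

variable {B : Type} [CommRing B] {d : ℕ}

/-- The endomorphisms of the module `M` given by multiplication by the elements `e_0, …, e_{d-1}`
of the ring. -/
abbrev mulEnd (e : Fin d → B) (M : Type) [AddCommGroup M] [Module B M] (i : Fin d) :
    Module.End B M :=
  LinearMap.lsmul B M (e i)

theorem mulEnd_commute (e : Fin d → B) (M : Type) [AddCommGroup M] [Module B M] (i j : Fin d) :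
    Commute (mulEnd e M i) (mulEnd e M j) :=
  LinearMap.ext fun m => smul_comm (e i) (e j) m

/-- The ideal generated by `e_0, …, e_{d-1}` annihilates their Koszul homology. -/
theorem exists_differential_eq_smul (e : Fin d → B) {M : Type} [AddCommGroup M] [Module B M]
    {q : ℕ} {z : Term M d (q + 1)} (hz : differential (mulEnd e M) q z = 0) {r : B}
    (hr : r ∈ Ideal.span (Set.range e)) :
    ∃ w, differential (mulEnd e M) (q + 1) w = r • z := by
  have key : Ideal.span (Set.range e) ≤
      (LinearMap.range (differential (mulEnd e M) (q + 1))).comap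
        (LinearMap.toSpanSingleton B _ z) := by
    rw [Ideal.span, Submodule.span_le]
    rintro _ ⟨i, rfl⟩
    refine ⟨wedge i (q + 1) z, funext fun T => ?_⟩
    have := differential_wedge (mulEnd e M) i q z T
    rw [hz] at this
    have h0 : wedge i q (0 : Term M d q) T = 0 := by
      rw [wedge]
      split_ifs
      · exact smul_zero _
      · rfl
    rw [h0, add_zero] at this
    exact this
  exact key hr

theorem exactAtSucc_of_le (e : Fin d → B) (M : Type) [AddCommGroup M] [Module B M] {q : ℕ}
    (h : d ≤ q) : ExactAtSucc (mulEnd e M) q := by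
  intro z _
  refine ⟨0, funext fun T => ?_⟩
  have h1 := T.2
  have h2 := T.1.card_le_univ
  rw [Fintype.card_fin] at h2
  omega

/-- The Koszul homology in degrees above `c`, represented by cycles, is torsion with respect to the
element `r`. -/
def IsTorsionAbove (e : Fin d → B) (M : Type) [AddCommGroup M] [Module B M] (c : ℕ) (r : B) :
    Prop :=
  ∀ q, c ≤ q → ∀ z : Term M d (q + 1), differential (mulEnd e M) q z = 0 →
    ∃ k : ℕ, ∃ w, differential (mulEnd e M) (q + 1) w = r ^ k • z

section quotient

variable (e : Fin d → B) {M : Type} [AddCommGroup M] [Module B M] (f : B)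

/-- The quotient map, applied to the coefficients of a Koszul chain. -/
def reduce {p : ℕ} (z : Term M d p) : Term (QuotSMulTop f M) d p :=
  fun I => Submodule.mkQ (f • (⊤ : Submodule B M)) (z I)

theorem reduce_smul_self {p : ℕ} (z : Term M d p) : reduce f (f • z) = 0 :=
  funext fun _ => (Submodule.Quotient.mk_eq_zero _).2
    (Submodule.smul_mem_pointwise_smul _ _ _ trivial)

theorem reduce_sub {p : ℕ} (z w : Term M d p) : reduce f (z - w) = reduce f z - reduce f w :=
  funext fun _ => map_sub _ _ _

theorem reduce_smul {p : ℕ} (r : B) (z : Term M d p) : reduce f (r • z) = r • reduce f z :=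
  funext fun _ => map_smul _ _ _

theorem differential_reduce (p : ℕ) (z : Term M d (p + 1)) :
    differential (mulEnd e (QuotSMulTop f M)) p (reduce f z) =
      reduce f (differential (mulEnd e M) p z) :=
  differential_map (φ := mulEnd e M) (φ' := mulEnd e (QuotSMulTop f M))
    (f := (Submodule.mkQ (f • (⊤ : Submodule B M))).toAddMonoidHom)
    (g := (Submodule.mkQ (f • (⊤ : Submodule B M))).toAddMonoidHom)
    (fun i m => map_smul (Submodule.mkQ (f • (⊤ : Submodule B M))) (e i) m) p z

theorem exists_reduce_eq {p : ℕ} (z : Term (QuotSMulTop f M) d p) :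
    ∃ y : Term M d p, reduce f y = z := by
  choose y hy using fun I => Submodule.Quotient.mk_surjective _ (z I)
  exact ⟨y, funext hy⟩

theorem exists_eq_smul_of_reduce_eq_zero {p : ℕ} {z : Term M d p}
    (hz : reduce f z = 0) :
    ∃ y : Term M d p, z = f • y := by
  have : ∀ I, ∃ y : M, f • y = z I := fun I => by
    have h := congrFun hz I
    have h' := (Submodule.Quotient.mk_eq_zero _).1 h
    obtain ⟨y, -, hy⟩ := (Submodule.mem_smul_pointwise_iff_exists _ _ _).1 h'
    exact ⟨y, hy⟩
  choose y hy using this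
  exact ⟨y, funext fun I => (hy I).symm⟩

variable {e f}

/-- The long exact homology sequence of multiplication by the regular element `f` shifts the bound
on the degrees by one. -/
theorem IsTorsionAbove.quotient (hf : IsSMulRegular M f) {c : ℕ} {g : B}
    (hg : IsTorsionAbove e M c g) : IsTorsionAbove e (QuotSMulTop f M) (c + 1) g := by
  have hf' : ∀ {p} {y y' : Term M d p}, f • y = f • y' → y = y' := fun h =>
    funext fun I => hf (congrFun h I)
  intro q hq z hz
  obtain ⟨q, rfl⟩ : ∃ q', q = q' + 1 := ⟨q - 1, by omega⟩
  obtain ⟨z, rfl⟩ := exists_reduce_eq f z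
  rw [differential_reduce] at hz
  obtain ⟨y, hy⟩ := exists_eq_smul_of_reduce_eq_zero f hz
  have hdy : differential (mulEnd e M) q y = 0 := by
    apply hf'
    rw [← map_smul, ← hy, differential_differential (mulEnd_commute e M), smul_zero]
  obtain ⟨k, w, hw⟩ := hg q (by omega) y hdy
  have hcyc : differential (mulEnd e M) (q + 1) (g ^ k • z - f • w) = 0 := by
    rw [map_sub, map_smul, map_smul, hw, hy, smul_comm, sub_self]
  obtain ⟨l, v, hv⟩ := hg (q + 1) (by omega) _ hcyc
  refine ⟨k + l, reduce f v, ?_⟩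
  rw [differential_reduce, hv]
  rw [reduce_smul, reduce_sub, reduce_smul_self, sub_zero, reduce_smul, smul_smul, ← pow_add,
    add_comm l k]

end quotient

/-- The acyclicity lemma for Koszul complexes: if the homology in degrees above `c` is torsion with
respect to every member of a weakly regular sequence of length at least `d - c`, then it vanishes.
Dividing by the first member of the sequence raises `c` by one, so induction applies; vanishing for
the quotient says that this member acts injectively on the homology in question. -/
theorem exactAtSucc_of_isWeaklyRegular (e : Fin d → B) (rs : List B) :
    ∀ (M : Type) [AddCommGroup M] [Module B M] (c : ℕ),
      RingTheory.Sequence.IsWeaklyRegular M rs → d ≤ rs.length + c →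
      (∀ r ∈ rs, IsTorsionAbove e M c r) → ∀ q, c ≤ q → ExactAtSucc (mulEnd e M) q := by
  induction rs with
  | nil =>
    intro M _ _ c _ hd _ q hq
    exact exactAtSucc_of_le e M (by simp at hd; omega)
  | cons f rs ih =>
    intro M _ _ c hreg hd htors q hq
    rw [RingTheory.Sequence.isWeaklyRegular_cons_iff] at hreg
    obtain ⟨hf, hrs⟩ := hreg
    have hf' : ∀ {p} {y y' : Term M d p}, f • y = f • y' → y = y' := fun h =>
      funext fun I => hf (congrFun h I)
    have hquot := ih (QuotSMulTop f M) (c + 1) hrs (by simp at hd; omega)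
      (fun r hr => (htors r (List.mem_cons_of_mem f hr)).quotient hf)
    have hinj : ∀ z : Term M d (q + 1), (∃ w, differential (mulEnd e M) (q + 1) w = f • z) →
        ∃ w, differential (mulEnd e M) (q + 1) w = z := by
      rintro z ⟨w, hw⟩
      obtain ⟨v, hv⟩ := hquot (q + 1) (by omega) (reduce f w) (by
        rw [differential_reduce, hw, reduce_smul_self])
      obtain ⟨v, rfl⟩ := exists_reduce_eq f v
      rw [differential_reduce] at hv
      obtain ⟨u, hu⟩ := exists_eq_smul_of_reduce_eq_zero f
        (z := w - differential (mulEnd e M) (q + 1 + 1) v) (by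
          rw [reduce_sub, hv, sub_self])
      refine ⟨u, hf' ?_⟩
      rw [← map_smul, ← hu, map_sub, hw, differential_differential (mulEnd_commute e M), sub_zero]
    intro z hz
    obtain ⟨k, hk⟩ := htors f List.mem_cons_self q hq z hz
    clear hz
    induction k generalizing z with
    | zero => simpa using hk
    | succ k ihk => exact ihk z (hinj _ (by simpa [pow_succ', mul_smul] using hk))

end Koszul

/-! ### Koszul homology over polynomial rings, prime by prime -/

namespace Koszul

variable {B : Type} [CommRing B] {d : ℕ}

/-- The ideal of those ring elements that carry a given Koszul chain to a boundary. -/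
def boundaryIdeal (e : Fin d → B) {q : ℕ} (z : Term B d (q + 1)) : Ideal B :=
  (LinearMap.range (differential (mulEnd e B) (q + 1))).comap (LinearMap.toSpanSingleton B _ z)

section localization

variable {B' : Type} [CommRing B'] [Algebra B B'] (N : Submonoid B) [IsLocalization N B']
  {e : Fin d → B}

/-- The image of a Koszul chain under a change of rings. -/
def extend (B' : Type) [CommRing B'] [Algebra B B'] {p : ℕ} (z : Term B d p) : Term B' d p :=
  fun I => algebraMap B B' (z I)

theorem extend_smul {p : ℕ} (b : B) (z : Term B d p) :
    extend B' (b • z) = algebraMap B B' b • extend B' z :=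
  funext fun _ => map_mul _ _ _

theorem extend_sub {p : ℕ} (z w : Term B d p) : extend B' (z - w) = extend B' z - extend B' w :=
  funext fun _ => map_sub _ _ _

theorem differential_extend {p : ℕ} (z : Term B d (p + 1)) :
    differential (mulEnd (fun i => algebraMap B B' (e i)) B') p (extend B' z) =
      extend B' (differential (mulEnd e B) p z) :=
  differential_map (φ := mulEnd e B) (φ' := mulEnd (fun i => algebraMap B B' (e i)) B')
    (f := (algebraMap B B').toAddMonoidHom) (g := (algebraMap B B').toAddMonoidHom)
    (fun i m => map_mul (algebraMap B B') (e i) m) p z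

include N

theorem exists_smul_eq_zero_of_extend_eq_zero {p : ℕ} {z : Term B d p}
    (hz : extend B' z = 0) : ∃ m ∈ N, m • z = 0 := by
  have : ∀ I, ∃ m : N, (m : B) * z I = 0 := fun I =>
    (IsLocalization.map_eq_zero_iff N B' (z I)).1 (congrFun hz I)
  choose m hm using this
  refine ⟨∏ I, (m I : B), N.prod_mem fun I _ => (m I).2, funext fun I => ?_⟩
  obtain ⟨k, hk⟩ := Finset.dvd_prod_of_mem (fun I => (m I : B)) (Finset.mem_univ I)
  change (∏ I, (m I : B)) * z I = 0
  rw [hk, mul_right_comm, hm, zero_mul]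

theorem exists_extend_eq_smul {p : ℕ} (z' : Term B' d p) :
    ∃ m ∈ N, ∃ z : Term B d p, extend B' z = algebraMap B B' m • z' := by
  obtain ⟨m, hm⟩ := IsLocalization.exist_integer_multiples_of_finite N z'
  choose z hz using hm
  refine ⟨m, m.2, z, funext fun I => ?_⟩
  rw [extend, hz, Algebra.smul_def]
  rfl

/-- If a Koszul chain becomes a boundary after localization, then a multiple of it by a denominator
is a boundary. -/
theorem exists_mem_boundaryIdeal {q : ℕ} {z : Term B d (q + 1)} {w' : Term B' d (q + 2)}
    (hw' : differential (mulEnd (fun i => algebraMap B B' (e i)) B') (q + 1) w' = extend B' z) :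
    ∃ m ∈ N, m ∈ boundaryIdeal e z := by
  obtain ⟨m, hm, w, hw⟩ := exists_extend_eq_smul N w'
  have : extend B' (differential (mulEnd e B) (q + 1) w - m • z) = 0 := by
    rw [extend_sub, ← differential_extend, hw, map_smul, hw', extend_smul, sub_self]
  obtain ⟨c, hc, h⟩ := exists_smul_eq_zero_of_extend_eq_zero N this
  refine ⟨c * m, N.mul_mem hc hm, c • w, ?_⟩
  rw [map_smul]
  rw [smul_sub, sub_eq_zero] at h
  rw [h]
  exact smul_smul _ _ _

/-- Up to a denominator, a cycle over the localization comes from a cycle over the ring. -/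
theorem exists_cycle_extend_eq_smul {q : ℕ} {z' : Term B' d (q + 1)}
    (hz' : differential (mulEnd (fun i => algebraMap B B' (e i)) B') q z' = 0) :
    ∃ m ∈ N, ∃ z : Term B d (q + 1), differential (mulEnd e B) q z = 0 ∧
      extend B' z = algebraMap B B' m • z' := by
  obtain ⟨m, hm, z, hz⟩ := exists_extend_eq_smul N z'
  have : extend B' (differential (mulEnd e B) q z) = 0 := by
    rw [← differential_extend, hz, map_smul, hz', smul_zero]
  obtain ⟨c, hc, h⟩ := exists_smul_eq_zero_of_extend_eq_zero N this
  refine ⟨c * m, N.mul_mem hc hm, c • z, by rw [map_smul, h], ?_⟩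
  rw [extend_smul, hz, smul_smul, map_mul]

end localization

theorem wellFoundedLT_primeSpectrum (S : Type*) [CommRing S] [IsNoetherianRing S] :
    WellFoundedLT (PrimeSpectrum S) := by
  have h : StrictMono fun P : PrimeSpectrum S => P.asIdeal.height := fun P Q h =>
    Ideal.height_strict_mono_of_isPrime h
  exact h.wellFoundedLT

open MvPolynomial in
attribute [local instance] algebraMvPolynomial in
/-- Vanishing of Koszul homology over a polynomial ring, checked at the primes of the coefficient
ring. At a prime `P`, induction on `P` shows that the localized homology is supported at `P`, hence
torsion with respect to the elements of `P`; it is annihilated by the ideal of the Koszul complex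
anyway. A long enough weakly regular sequence of elements of these two kinds makes the acyclicity
lemma applicable. -/
theorem exactAtSucc_mvPolynomial {S : Type} [CommRing S] [IsNoetherianRing S] {σ : Type}
    (e : Fin d → MvPolynomial σ S)
    (H : ∀ (P : Ideal S) [P.IsPrime], ∃ rs : List (MvPolynomial σ (Localization.AtPrime P)),
      RingTheory.Sequence.IsWeaklyRegular (MvPolynomial σ (Localization.AtPrime P)) rs ∧
      d ≤ rs.length ∧
      ∀ r ∈ rs, (∃ m ∈ IsLocalRing.maximalIdeal (Localization.AtPrime P), r = C m) ∨
        r ∈ Ideal.span (Set.range fun i => map (algebraMap S (Localization.AtPrime P)) (e i)))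
    (q : ℕ) : ExactAtSucc (mulEnd e (MvPolynomial σ S)) q := by
  have := wellFoundedLT_primeSpectrum S
  have key : ∀ P : PrimeSpectrum S, ∀ q (z : Term (MvPolynomial σ S) d (q + 1)),
      differential (mulEnd e _) q z = 0 → ∃ s ∉ P.asIdeal, C s ∈ boundaryIdeal e z := by
    intro P
    induction P using WellFoundedLT.induction with
    | ind P ih =>
    intro q z hz
    let S' := Localization.AtPrime P.asIdeal
    let N := P.asIdeal.primeCompl.map (C (σ := σ) (R := S))
    have hN : IsLocalization N (MvPolynomial σ S') := isLocalization _ _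
    obtain ⟨rs, hreg, hlen, hrs⟩ := H P.asIdeal
    have hex := exactAtSucc_of_isWeaklyRegular
      (fun i => algebraMap (MvPolynomial σ S) (MvPolynomial σ S') (e i)) rs
      (MvPolynomial σ S') 0 hreg (by simpa using hlen) (by
        intro r hr q _ z' hz'
        rcases hrs r hr with ⟨m, hm, rfl⟩ | hr
        · let b : Ideal S' := (boundaryIdeal
            (fun i => algebraMap (MvPolynomial σ S) (MvPolynomial σ S') (e i)) z').comap C
          -- It is enough to show that some power of `m` lies in `b`.
          suffices h : m ∈ b.radical by
            obtain ⟨k, hk⟩ := h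
            refine ⟨k, ?_⟩
            rw [← map_pow]
            exact hk
          rw [Ideal.radical_eq_sInf, Ideal.mem_sInf]
          rintro Q ⟨hbQ, hQ⟩
          -- A prime `Q` over `b` without `m` lies over a prime strictly below `P`.
          by_contra hmQ
          have hlt : (⟨Q.under S, inferInstance⟩ : PrimeSpectrum S) < P := by
            have hle : Q.under S ≤ P.asIdeal :=
              (Ideal.comap_mono (IsLocalRing.le_maximalIdeal hQ.ne_top)).trans_eq
                Localization.AtPrime.under_maximalIdeal
            refine lt_of_le_of_ne hle fun h => hmQ ?_
            have h' : Q.under S = P.asIdeal := congrArg PrimeSpectrum.asIdeal h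
            rw [Localization.AtPrime.eq_maximalIdeal_iff_under_eq.1 h']
            exact hm
          obtain ⟨_, ⟨m', hm', rfl⟩, y, hy, hyz⟩ := exists_cycle_extend_eq_smul N hz'
          obtain ⟨s, hs, w, hw⟩ := ih _ hlt q y hy
          apply hs
          have hmem : algebraMap S S' (s * m') ∈ b := by
            refine ⟨extend _ w, ?_⟩
            rw [differential_extend, hw, LinearMap.toSpanSingleton_apply,
              LinearMap.toSpanSingleton_apply, extend_smul, hyz, smul_smul, ← map_mul, ← map_mul,
              algebraMap_def, MvPolynomial.map_C]
          have h2 := hbQ hmem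
          rw [map_mul] at h2
          refine (hQ.mem_or_mem h2).resolve_right fun h3 => hQ.ne_top ?_
          exact Ideal.eq_top_of_isUnit_mem _ h3 (IsLocalization.map_units S' ⟨m', hm'⟩)
        · exact ⟨1, by rw [pow_one]; exact exists_differential_eq_smul _ hz' hr⟩)
    obtain ⟨w', hw'⟩ := hex q (Nat.zero_le q) (extend _ z) (by
      rw [differential_extend, hz]
      exact funext fun _ => map_zero _)
    obtain ⟨_, ⟨s, hs, rfl⟩, h⟩ := exists_mem_boundaryIdeal N hw'
    exact ⟨s, hs, h⟩
  intro z hz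
  have htop : (boundaryIdeal e z).comap C = ⊤ := by
    by_contra h
    obtain ⟨P, hP, hle⟩ := Ideal.exists_le_maximal _ h
    obtain ⟨s, hs, hsz⟩ := key ⟨P, hP.isPrime⟩ q z hz
    exact hs (hle hsz)
  have h1 : (1 : S) ∈ (boundaryIdeal e z).comap C := htop ▸ trivial
  obtain ⟨w, hw⟩ := h1
  exact ⟨w, by rw [hw, map_one]; exact one_smul _ _⟩

end Koszul

/-! ### The normal form of operators in the Weyl algebra -/

namespace WeylAlgebra

open MvPolynomial

variable {n : ℕ}

/-- The variables and the derivations generate the Weyl algebra. -/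
theorem mem_of_generators (T : Subalgebra ℂ (WeylAlgebra n)) (hx : ∀ j, x j ∈ T)
    (hd : ∀ j, der j ∈ T) (P : WeylAlgebra n) : P ∈ T := by
  obtain ⟨P, hP⟩ := P
  refine Algebra.adjoin_induction (p := fun Q hQ => (⟨Q, hQ⟩ : WeylAlgebra n) ∈ T)
    ?_ ?_ ?_ ?_ hP
  · rintro _ (⟨j, rfl⟩ | ⟨j, rfl⟩)
    · exact hx j
    · exact hd j
  · exact fun c => T.algebraMap_mem c
  · exact fun _ _ _ _ h1 h2 => T.add_mem h1 h2
  · exact fun _ _ _ _ h1 h2 => T.mul_mem h1 h2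

/-- The inclusion `ℂ[x] → D` of the polynomials as multiplication operators. -/
noncomputable def ofVar : MvPolynomial (Fin n) ℂ →ₐ[ℂ] WeylAlgebra n :=
  (Algebra.lmul ℂ (MvPolynomial (Fin n) ℂ)).codRestrict (Algebra.adjoin ℂ _) (by
    intro f
    induction f using MvPolynomial.induction_on with
    | C c =>
      have : Algebra.lmul ℂ (MvPolynomial (Fin n) ℂ) (C c) = algebraMap ℂ _ c :=
        (Algebra.lmul ℂ (MvPolynomial (Fin n) ℂ)).commutes c
      rw [this]
      exact Subalgebra.algebraMap_mem _ c
    | add p q hp hq =>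
      rw [map_add]
      exact add_mem hp hq
    | mul_X p j hp =>
      rw [map_mul]
      exact mul_mem hp (Algebra.subset_adjoin (Or.inl ⟨j, rfl⟩)))

theorem val_ofVar (f g : MvPolynomial (Fin n) ℂ) : val (ofVar f) g = f * g := rfl

theorem ofVar_X (j : Fin n) : ofVar (X j) = x j := rfl

theorem der_mul_ofVar (j : Fin n) (f : MvPolynomial (Fin n) ℂ) :
    der j * ofVar f = ofVar f * der j + ofVar (pderiv j f) := by
  apply val_injective
  refine LinearMap.ext fun g => ?_
  rw [map_mul, map_add, map_mul, LinearMap.add_apply, Module.End.mul_apply, Module.End.mul_apply,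
    val_ofVar, val_ofVar, val_der, val_der, val_ofVar, pderiv_mul, add_comm]

theorem ofOp_mul_x (f : OpRing n) (j : Fin n) :
    ofOp f * x j = x j * ofOp f + ofOp (pderiv j f) := by
  induction f using MvPolynomial.induction_on with
  | C c =>
    have : ofOp (C c : OpRing n) = algebraMap ℂ _ c := ofOp.commutes c
    rw [this, pderiv_C, map_zero, add_zero, Algebra.commutes]
  | add p q hp hq =>
    simp only [map_add, add_mul, mul_add, hp, hq]
    abel
  | mul_X p i hp =>
    rw [map_mul, ofOp_X, mul_assoc, der_mul_x, mul_add, ← mul_assoc, hp, pderiv_mul, pderiv_X,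
      map_add, map_mul, map_mul, ofOp_X, add_mul, mul_assoc, add_assoc]
    congr 2
    by_cases h : i = j
    · subst h
      simp
    · simp [h]

theorem val_ofOp_one (f : OpRing n) : val (ofOp f) 1 = C (constantCoeff f) := by
  induction f using MvPolynomial.induction_on with
  | C c =>
    have : ofOp (C c : OpRing n) = algebraMap ℂ _ c := ofOp.commutes c
    rw [this, AlgHom.commutes, constantCoeff_C, Module.algebraMap_end_apply, smul_eq_C_mul, mul_one]
  | add p q hp hq => rw [map_add, map_add, LinearMap.add_apply, hp, hq, map_add, map_add]
  | mul_X p i hp =>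
    rw [map_mul, ofOp_X, map_mul, Module.End.mul_apply, val_der, pderiv_one, map_zero, map_mul,
      constantCoeff_X, mul_zero, map_zero]

/-- The operator `x ^ u`. -/
noncomputable def xPow (u : Fin n →₀ ℕ) : WeylAlgebra n := ofVar (monomial u 1)

theorem xPow_zero : xPow (0 : Fin n →₀ ℕ) = 1 := map_one ofVar

theorem xPow_mul_x (u : Fin n →₀ ℕ) (j : Fin n) : xPow u * x j = xPow (u + Finsupp.single j 1) := by
  rw [xPow, ← ofVar_X, ← map_mul, X, monomial_mul, one_mul, xPow]

theorem x_mul_xPow (u : Fin n →₀ ℕ) (j : Fin n) : x j * xPow u = xPow (u + Finsupp.single j 1) := by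
  rw [xPow, ← ofVar_X, ← map_mul, X, monomial_mul, one_mul, xPow, add_comm]

/-- The operator `∑_u x ^ u f_u(∂)` with coefficients `f_u` in `ℂ[∂]`, written on the right. -/
noncomputable def normalForm : ((Fin n →₀ ℕ) →₀ OpRing n) →ₗ[OpRing n] WeylAlgebra n :=
  Finsupp.linearCombination (OpRing n) xPow

theorem normalForm_single (u : Fin n →₀ ℕ) (f : OpRing n) :
    normalForm (Finsupp.single u f) = xPow u * ofOp f := by
  rw [normalForm, Finsupp.linearCombination_single, op_smul_def]

theorem normalForm_mul_x (g : (Fin n →₀ ℕ) →₀ OpRing n) (j : Fin n) :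
    normalForm g * x j = x j * normalForm g +
      normalForm (g.mapRange (pderiv j) (map_zero _)) := by
  induction g using Finsupp.induction_linear with
  | zero => simp
  | add p q hp hq =>
    rw [map_add, add_mul, hp, hq, Finsupp.mapRange_add (map_add _), map_add, mul_add]
    abel
  | single u f =>
    rw [Finsupp.mapRange_single, normalForm_single, normalForm_single, mul_assoc, ofOp_mul_x,
      mul_add, ← mul_assoc, ← mul_assoc, xPow_mul_x, x_mul_xPow]

theorem coeff_val_normalForm_one (g : (Fin n →₀ ℕ) →₀ OpRing n) (u : Fin n →₀ ℕ) :
    coeff u (val (normalForm g) 1) = constantCoeff (g u) := by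
  induction g using Finsupp.induction_linear with
  | zero => simp
  | add p q hp hq => rw [map_add, map_add, LinearMap.add_apply, coeff_add, hp, hq,
      Finsupp.add_apply, map_add]
  | single v f =>
    rw [normalForm_single, map_mul, Module.End.mul_apply, val_ofOp_one, xPow, val_ofVar,
      mul_comm, C_mul_monomial, mul_one, coeff_monomial, Finsupp.single_apply]
    split_ifs <;> simp

/-- Normal forms are unique: the commutator with `x_j` differentiates the coefficients with respect
to `∂_j`, and the value at `1` consists of their constant terms, so every Taylor coefficient of
every `f_u` can be read off. -/
theorem normalForm_injective : Function.Injective (normalForm (n := n)) := by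
  rw [injective_iff_map_eq_zero]
  have key : ∀ (k : ℕ) (w : Fin n →₀ ℕ), w.degree = k →
      ∀ g : (Fin n →₀ ℕ) →₀ OpRing n, normalForm g = 0 → ∀ u, coeff w (g u) = 0 := by
    intro k
    induction k with
    | zero =>
      intro w hw g hg u
      obtain rfl := (Finsupp.degree_eq_zero_iff w).1 hw
      have := coeff_val_normalForm_one g u
      rw [hg, map_zero, LinearMap.zero_apply, coeff_zero] at this
      exact this.symm
    | succ k ih =>
      intro w hw g hg u
      obtain ⟨j, hj⟩ : ∃ j, w j ≠ 0 := by
        by_contra! h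
        have : w = 0 := Finsupp.ext h
        simp [this] at hw
      obtain ⟨w, rfl⟩ : ∃ w', w = w' + Finsupp.single j 1 :=
        ⟨w - Finsupp.single j 1,
          (tsub_add_cancel_of_le (by simpa using Nat.one_le_iff_ne_zero.2 hj)).symm⟩
      have hw' : w.degree = k := by simpa using hw
      have h0 : normalForm (g.mapRange (pderiv j) (map_zero _)) = 0 := by
        have := normalForm_mul_x g j
        rw [hg, zero_mul, mul_zero, zero_add] at this
        exact this.symm
      have h1 := ih w hw' _ h0 u
      rw [Finsupp.mapRange_apply, coeff_pderiv] at h1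
      exact (mul_eq_zero.1 h1).resolve_right (by exact_mod_cast Nat.succ_ne_zero (w j))
  intro g hg
  exact Finsupp.ext fun u => MvPolynomial.ext _ _ fun w => key _ w rfl g hg u

/-- Every operator has a normal form: the operators in normal form contain `1` and are stable under
multiplication by the generators from the left. -/
theorem normalForm_surjective : Function.Surjective (normalForm (n := n)) := by
  let W := LinearMap.range (normalForm (n := n))
  have hW : ∀ u f, xPow u * ofOp f ∈ W := fun u f => ⟨_, normalForm_single u f⟩
  have hder : ∀ (f : MvPolynomial (Fin n) ℂ) (r : OpRing n), ofVar f * ofOp r ∈ W := by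
    intro f r
    induction f using MvPolynomial.induction_on' with
    | monomial u c =>
      have h1 : monomial u c = monomial u 1 * C c := by rw [mul_comm, C_mul_monomial, mul_one]
      have h2 : ofVar (C c) = ofOp (C c : OpRing n) :=
        (ofVar.commutes c).trans (ofOp.commutes c).symm
      rw [h1, map_mul, h2, mul_assoc, ← map_mul]
      exact hW u _
    | add p q hp hq =>
      rw [map_add, add_mul]
      exact W.add_mem hp hq
  let T : Subalgebra ℂ (WeylAlgebra n) :=
    { carrier := {Q | ∀ P ∈ W, Q * P ∈ W}
      mul_mem' := fun {Q Q'} h h' P hP => by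
        rw [mul_assoc]
        exact h _ (h' P hP)
      add_mem' := fun {Q Q'} h h' P hP => by
        rw [add_mul]
        exact W.add_mem (h P hP) (h' P hP)
      algebraMap_mem' := fun c P hP => by
        rw [Algebra.commutes]
        have : ofOp (C c : OpRing n) = algebraMap ℂ _ c := ofOp.commutes c
        rw [← this]
        exact W.smul_mem (C c) hP }
  have hT : ∀ Q : WeylAlgebra n, (∀ u r, Q * (xPow u * ofOp r) ∈ W) → Q ∈ T := by
    rintro Q hQ _ ⟨g, rfl⟩
    induction g using Finsupp.induction_linear with
    | zero => simp
    | add p q hp hq =>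
      rw [map_add, mul_add]
      exact W.add_mem hp hq
    | single u f =>
      rw [normalForm_single]
      exact hQ u f
  intro P
  have hP : P ∈ T := mem_of_generators T
    (fun j => hT _ fun u r => by
      rw [← mul_assoc, x_mul_xPow]
      exact hW _ r)
    (fun j => hT _ fun u r => by
      rw [← mul_assoc, xPow, der_mul_ofVar, add_mul, mul_assoc, ← ofOp_X, ← map_mul]
      exact W.add_mem (hder _ _) (hder _ _)) P
  have h1 : (1 : WeylAlgebra n) ∈ W := by
    have := hW 0 1
    rwa [xPow_zero, map_one, mul_one] at this
  have := hP 1 h1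
  rwa [mul_one] at this

/-- The monomials `x ^ u` form a basis of the Weyl algebra as a right module over `ℂ[∂]`. -/
noncomputable def xPowBasis : Module.Basis (Fin n →₀ ℕ) (OpRing n) (WeylAlgebra n) :=
  Module.Basis.ofRepr (LinearEquiv.ofBijective normalForm
    ⟨normalForm_injective, normalForm_surjective⟩).symm

theorem xPowBasis_apply (u : Fin n →₀ ℕ) : xPowBasis u = xPow u := by
  change normalForm (Finsupp.single u 1) = _
  rw [normalForm_single, map_one, mul_one]

end WeylAlgebra

/-! ### Perturbation of graded Koszul complexes -/

namespace Koszul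

variable {D : Type} [Ring D] {M : Type} [AddCommGroup M] [Module D M] {d : ℕ}

/-- Perturbation of a graded Koszul complex. The maps `π k` are the projections onto the
homogeneous components; `σ i` raises degrees by one and `δ i` preserves them. If the
Koszul complex of the leading parts `σ i` is exact in some positive degree, then so is that of the
sums `σ i + δ i`: the top component of a cycle for the sums is a cycle for the leading parts, and
subtracting a boundary removes it. -/
theorem ExactAtSucc.add_of_graded {σ δ : Fin d → Module.End D M} (π : ℕ → M →+ M)
    (hπ : ∀ k l m, π k (π l m) = if k = l then π l m else 0)
    (hbound : ∀ m, ∃ N, ∀ k, N ≤ k → π k m = 0) (hsep : ∀ m, (∀ k, π k m = 0) → m = 0)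
    (hσ : ∀ k i m, π (k + 1) (σ i m) = σ i (π k m)) (hσ0 : ∀ i m, π 0 (σ i m) = 0)
    (hδ : ∀ k i m, π k (δ i m) = δ i (π k m))
    (hcomm : ∀ i j, Commute (σ i + δ i) (σ j + δ j)) {q : ℕ} (h : ExactAtSucc σ q) :
    ExactAtSucc (fun i => σ i + δ i) q := by
  have hdσ : ∀ k p (z : Term M d (p + 1)), differential σ p (fun I => π k (z I)) =
      fun T => π (k + 1) (differential σ p z T) :=
    fun k p z => differential_map (f := π k) (g := π (k + 1)) (hσ k) p z
  have hdδ : ∀ k p (z : Term M d (p + 1)), differential δ p (fun I => π k (z I)) =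
      fun T => π k (differential δ p z T) :=
    fun k p z => differential_map (f := π k) (g := π k) (hδ k) p z
  have hdσ0 : ∀ p (z : Term M d (p + 1)) T, π 0 (differential σ p z T) = 0 := fun p z T => by
    have := congrFun (differential_map (φ := σ) (φ' := σ) (f := 0) (g := π 0)
      (fun i m => (hσ0 i m).trans (map_zero (σ i)).symm) p z) T
    rw [← this]
    exact congrFun (map_zero (differential σ p)) T
  have key : ∀ N (z : Term M d (q + 1)), differential (fun i => σ i + δ i) q z = 0 →
      (∀ k, N ≤ k → ∀ I, π k (z I) = 0) →
      ∃ w, differential (fun i => σ i + δ i) (q + 1) w = z := by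
    intro N
    induction N with
    | zero =>
      intro z _ hN
      refine ⟨0, ?_⟩
      rw [map_zero]
      exact funext fun I => (hsep _ fun k => hN k (Nat.zero_le k) I).symm
    | succ N ih =>
      intro z hz hN
      obtain ⟨w, hw⟩ := h (fun I => π N (z I)) (by
        have h1 : (fun I => π (N + 1) (z I)) = (0 : Term M d (q + 1)) :=
          funext fun I => hN (N + 1) le_rfl I
        have h2 := hdδ (N + 1) q z
        rw [h1, map_zero] at h2
        rw [differential_add] at hz
        rw [hdσ]
        funext T
        have h3 := congrArg (π (N + 1)) (congrFun hz T)
        rw [Pi.add_apply, map_add, ← congrFun h2 T, Pi.zero_apply, add_zero, map_zero] at h3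
        exact h3)
      cases N with
      -- In degree zero nothing has to be subtracted, because leading parts have positive degree.
      | zero =>
        refine ih z hz fun k _ I => ?_
        rcases Nat.eq_zero_or_pos k with rfl | hk
        · have h1 := congrArg (π 0) (congrFun hw I)
          rw [hdσ0, hπ, if_pos rfl] at h1
          exact h1.symm
        · exact hN k hk I
      | succ N =>
        let v : Term M d (q + 2) := fun I => π N (w I)
        have hv : differential σ (q + 1) v = fun I => π (N + 1) (z I) := by
          rw [hdσ, hw]
          exact funext fun I => by rw [hπ, if_pos rfl]
        have hdd : differential (fun i => σ i + δ i) q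
            (differential (fun i => σ i + δ i) (q + 1) v) = 0 :=
          differential_differential hcomm q v
        obtain ⟨u, hu⟩ := ih (z - differential (fun i => σ i + δ i) (q + 1) v)
          (by rw [map_sub, hz, hdd, sub_self]) (fun k hk I => by
            rw [differential_add, hv]
            change π k (z I - (π (N + 1) (z I) + differential δ (q + 1) v I)) = 0
            have hδv : π k (differential δ (q + 1) v I) = 0 := by
              have h1 := hdδ k (q + 1) v
              have h2 : (fun I => π k (v I)) = (0 : Term M d (q + 2)) :=
                funext fun I => by
                  change π k (π N (w I)) = 0
                  rw [hπ, if_neg (by omega)]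
              rw [h2, map_zero] at h1
              exact (congrFun h1 I).symm
            rw [map_sub, map_add, hδv, hπ, add_zero]
            split_ifs with hkN
            · rw [hkN, sub_self]
            · rw [hN k (by omega), sub_zero])
        exact ⟨u + v, by rw [map_add, hu, sub_add_cancel]⟩
  intro z hz
  choose N hN using fun I => hbound (z I)
  exact key (Finset.univ.sup N) z hz fun k hk I =>
    hN I k ((Finset.le_sup (Finset.mem_univ I)).trans hk)

end Koszul

/-! ### The Euler–Koszul complex and the symbols of the Euler operators -/

namespace EulerKoszul

open MvPolynomial

variable {d n : ℕ} (A : Matrix (Fin d) (Fin n) ℤ)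

/-- The symbol `∑_j a_{i,j} t^{a_j} x_j ∈ S_A[x]` of the Euler operator `E_i`, for the filtration
of the Weyl algebra by the order in `x`. -/
noncomputable def symbol (i : Fin d) : MvPolynomial (Fin n) (ToricRing A) :=
  ∑ j, MvPolynomial.monomial (Finsupp.single j 1) (A i j • monomial A (col A j))

/-- The additive map on polynomials that applies `g` to all coefficients. -/
noncomputable def mapCoeff {R σ : Type*} [CommRing R] (g : R →+ R) :
    MvPolynomial σ R →+ MvPolynomial σ R :=
  ((basisMonomials σ R).repr.symm.toLinearMap.toAddMonoidHom.comp
    (Finsupp.mapRange.addMonoidHom g)).comp (basisMonomials σ R).repr.toLinearMap.toAddMonoidHom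

theorem coeff_mapCoeff {R σ : Type*} [CommRing R] (g : R →+ R) (u : σ →₀ ℕ)
    (b : MvPolynomial σ R) : coeff u (mapCoeff g b) = g (coeff u b) := rfl

theorem mapCoeff_monomial {R σ : Type*} [CommRing R] (g : R →+ R) (u : σ →₀ ℕ) (y : R) :
    mapCoeff g (MvPolynomial.monomial u y) = MvPolynomial.monomial u (g y) := by
  classical
  ext v
  rw [coeff_mapCoeff, coeff_monomial, coeff_monomial]
  split_ifs
  · rfl
  · exact map_zero g

/-- The degree-preserving part `t^h x^u ↦ (h_i - β_i) t^h x^u` of the Euler operator. -/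
noncomputable def diagonal (β : Fin d → ℂ) (i : Fin d) :
    MvPolynomial (Fin n) (ToricRing A) →+ MvPolynomial (Fin n) (ToricRing A) :=
  mapCoeff (weight A i - β i • LinearMap.id).toAddMonoidHom

/-- The identification of `S_A[x]` with `D_A ⊗ S_A` that sends `y x^u` to `x^u ⊗ y`. -/
noncomputable def polyEquiv : MvPolynomial (Fin n) (ToricRing A) ≃+ Mod A :=
  (basisMonomials (Fin n) (ToricRing A)).repr.toAddEquiv.trans
    (TensorProduct.equivFinsuppOfBasisLeft WeylAlgebra.xPowBasis).symm.toAddEquiv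

theorem polyEquiv_monomial (u : Fin n →₀ ℕ) (y : ToricRing A) :
    polyEquiv A (MvPolynomial.monomial u y) = WeylAlgebra.xPow u ⊗ₜ y := by
  have h : (basisMonomials (Fin n) (ToricRing A)).repr (MvPolynomial.monomial u y) =
      Finsupp.single u y := by
    classical
    ext v
    exact (coeff_monomial v u y).trans (Finsupp.single_apply).symm
  change (TensorProduct.equivFinsuppOfBasisLeft WeylAlgebra.xPowBasis).symm
    ((basisMonomials (Fin n) (ToricRing A)).repr (MvPolynomial.monomial u y)) = _
  rw [h, TensorProduct.equivFinsuppOfBasisLeft_symm_apply,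
    Finsupp.sum_single_index (by rw [TensorProduct.tmul_zero]), WeylAlgebra.xPowBasis_apply]

theorem symbol_mul_monomial (i : Fin d) (u : Fin n →₀ ℕ) (y : ToricRing A) :
    symbol A i * MvPolynomial.monomial u y =
      ∑ j, MvPolynomial.monomial (u + Finsupp.single j 1) (A i j • (monomial A (col A j) * y)) := by
  rw [symbol, Finset.sum_mul]
  refine Finset.sum_congr rfl fun j _ => ?_
  rw [MvPolynomial.monomial_mul, add_comm, smul_mul_assoc]

theorem polyEquiv_symbol_add_diagonal (β : Fin d → ℂ) (i : Fin d)
    (b : MvPolynomial (Fin n) (ToricRing A)) :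
    polyEquiv A (symbol A i * b + diagonal A β i b) = eulerEnd A β i (polyEquiv A b) := by
  induction b using MvPolynomial.induction_on' with
  | add p q hp hq =>
    rw [map_add (polyEquiv A) p q, map_add (eulerEnd A β i), ← hp, ← hq, ← map_add, mul_add,
      map_add (diagonal A β i), add_add_add_comm]
  | monomial u y =>
    rw [symbol_mul_monomial, diagonal, mapCoeff_monomial, map_add, map_sum, polyEquiv_monomial,
      polyEquiv_monomial, eulerEnd_tmul, euler, mul_sub, Finset.mul_sum, TensorProduct.sub_tmul,
      TensorProduct.sum_tmul]
    have h1 : ∀ j, polyEquiv A (MvPolynomial.monomial (u + Finsupp.single j 1)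
        (A i j • (monomial A (col A j) * y))) =
        (WeylAlgebra.xPow u * (A i j • (WeylAlgebra.x j * WeylAlgebra.der j))) ⊗ₜ y := by
      intro j
      rw [polyEquiv_monomial, ← X_smul, TensorProduct.tmul_smul, mul_smul_comm,
        ← TensorProduct.smul_tmul', ← mul_assoc, WeylAlgebra.xPow_mul_x, ← WeylAlgebra.ofOp_X,
        ← WeylAlgebra.op_smul_def, TensorProduct.smul_tmul]
    have h2 : (WeylAlgebra.xPow u * algebraMap ℂ (WeylAlgebra n) (β i)) ⊗ₜ[WeylAlgebra.OpRing n] y =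
        WeylAlgebra.xPow u ⊗ₜ (β i • y) := by
      have h3 : WeylAlgebra.ofOp (C (β i) : WeylAlgebra.OpRing n) = algebraMap ℂ _ (β i) :=
        WeylAlgebra.ofOp.commutes (β i)
      rw [← h3, ← WeylAlgebra.op_smul_def, TensorProduct.smul_tmul, C_smul]
    have h4 : (weight A i - β i • LinearMap.id).toAddMonoidHom y = weight A i y - β i • y := rfl
    rw [Finset.sum_congr rfl fun j _ => h1 j, h2, h4, TensorProduct.tmul_sub]
    abel

theorem isHomogeneous_symbol (i : Fin d) : (symbol A i).IsHomogeneous 1 :=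
  IsHomogeneous.sum _ _ _ fun j _ => isHomogeneous_monomial _ (by simp)

theorem homogeneousComponent_symbol_mul_monomial (k : ℕ) (i : Fin d) (u : Fin n →₀ ℕ)
    (y : ToricRing A) :
    homogeneousComponent k (symbol A i * MvPolynomial.monomial u y) =
      if k = 1 + u.degree then symbol A i * MvPolynomial.monomial u y else 0 :=
  homogeneousComponent_of_mem ((isHomogeneous_symbol A i).mul (isHomogeneous_monomial y rfl))

theorem homogeneousComponent_symbol_mul (k : ℕ) (i : Fin d)
    (b : MvPolynomial (Fin n) (ToricRing A)) :
    homogeneousComponent (k + 1) (symbol A i * b) = symbol A i * homogeneousComponent k b := by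
  induction b using MvPolynomial.induction_on' with
  | add p q hp hq => rw [mul_add, map_add, map_add, mul_add, hp, hq]
  | monomial u y =>
    rw [homogeneousComponent_symbol_mul_monomial,
      homogeneousComponent_of_mem (isHomogeneous_monomial y rfl), add_comm k, mul_ite, mul_zero]
    simp only [add_right_inj]

theorem homogeneousComponent_zero_symbol_mul (i : Fin d)
    (b : MvPolynomial (Fin n) (ToricRing A)) :
    homogeneousComponent 0 (symbol A i * b) = 0 := by
  induction b using MvPolynomial.induction_on' with
  | add p q hp hq => rw [mul_add, map_add, hp, hq, add_zero]
  | monomial u y => rw [homogeneousComponent_symbol_mul_monomial, if_neg (by omega)]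

/-- The Euler–Koszul complex is exact in a positive degree if the Koszul complex of the symbols
on `S_A[x]` is. -/
theorem exactAtSucc_eulerEnd {q : ℕ}
    (h : Koszul.ExactAtSucc (Koszul.mulEnd (symbol A) (MvPolynomial (Fin n) (ToricRing A))) q)
    (β : Fin d → ℂ) : Koszul.ExactAtSucc (eulerEnd A β) q := by
  let B := MvPolynomial (Fin n) (ToricRing A)
  let σ : Fin d → Module.End ℤ B := fun i => (AddMonoidHom.mulLeft (symbol A i)).toIntLinearMap
  let δ : Fin d → Module.End ℤ B := fun i => (diagonal A β i).toIntLinearMap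
  have hconj : ∀ i b, polyEquiv A ((σ i + δ i) b) = eulerEnd A β i (polyEquiv A b) :=
    polyEquiv_symbol_add_diagonal A β
  have hσ : Koszul.ExactAtSucc σ q := h.of_addEquiv (φ' := σ) (AddEquiv.refl B) (fun i m => rfl)
  refine Koszul.ExactAtSucc.of_addEquiv (polyEquiv A) hconj
    (hσ.add_of_graded (δ := δ) (fun k => (homogeneousComponent k).toAddMonoidHom)
      ?_ ?_ ?_ ?_ ?_ ?_ ?_)
  · exact fun k l m => homogeneousComponent_of_mem (homogeneousComponent_mem l m)
  · exact fun m => ⟨m.totalDegree + 1, fun k hk => homogeneousComponent_eq_zero _ _ hk⟩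
  · intro m hm
    rw [← sum_homogeneousComponent m]
    exact Finset.sum_eq_zero fun k _ => hm k
  · exact fun k i m => homogeneousComponent_symbol_mul A k i m
  · exact fun i m => homogeneousComponent_zero_symbol_mul A i m
  · intro k i m
    change homogeneousComponent k (diagonal A β i m) = diagonal A β i (homogeneousComponent k m)
    ext u
    rw [coeff_homogeneousComponent, diagonal, coeff_mapCoeff, coeff_mapCoeff,
      coeff_homogeneousComponent]
    split_ifs
    · rfl
    · exact (map_zero _).symm
  · intro i j
    refine LinearMap.ext fun b => (polyEquiv A).injective ?_
    rw [Module.End.mul_apply, Module.End.mul_apply, hconj, hconj, hconj, hconj]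
    exact LinearMap.congr_fun (eulerEnd_comm A β i j).eq _

end EulerKoszul

/-! ### Heights and transcendence degrees -/

section dimension

/-- The property that every prime `P` of `R` with residue ring of transcendence degree at most `r`
over `k` has height at least `s - r`; the bound is stated without subtraction. -/
def HeightAddTrdegGE (k R : Type) [Field k] [CommRing R] [Algebra k R] (s : ℕ) : Prop :=
  ∀ (P : Ideal R) [P.IsPrime] (r : ℕ), Algebra.trdeg k (R ⧸ P) ≤ r → (s : ℕ∞) ≤ P.height + r

variable {k : Type} [Field k]

theorem HeightAddTrdegGE.of_algEquiv {R R' : Type} [CommRing R] [Algebra k R] [CommRing R']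
    [Algebra k R'] (e : R ≃ₐ[k] R') {s : ℕ} (h : HeightAddTrdegGE k R s) :
    HeightAddTrdegGE k R' s := by
  intro P _ r hr
  have h1 : (P.comap e.toRingEquiv).height = P.height := e.toRingEquiv.height_comap P
  rw [← h1]
  refine h (P.comap e.toRingEquiv) r (le_trans (le_of_eq ?_) hr)
  refine AlgEquiv.trdeg_eq (Ideal.quotientEquivAlg _ _ e ?_)
  exact (Ideal.map_comap_of_surjective e.toRingEquiv e.surjective P).symm

theorem Ideal.height_under_le_height {R R' : Type} [CommRing R] [CommRing R'] [Algebra R R']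
    [IsNoetherianRing R] [IsNoetherianRing R'] [Algebra.HasGoingDown R R'] (P : Ideal R')
    [P.IsPrime] :
    (P.under R).height ≤ P.height := by
  rw [Ideal.height_eq_height_add_of_liesOver_of_hasGoingDown (P.under R) P]
  exact le_self_add

theorem trdeg_quotient_under_le {R R' : Type} [CommRing R] [CommRing R'] [Algebra k R]
    [Algebra k R'] [Algebra R R'] [IsScalarTower k R R'] (P : Ideal R') [P.IsPrime] :
    Algebra.trdeg k (R ⧸ P.under R) ≤ Algebra.trdeg k (R' ⧸ P) :=
  trdeg_le_of_injective (IsScalarTower.toAlgHom k (R ⧸ P.under R) (R' ⧸ P))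
    (FaithfulSMul.algebraMap_injective _ _)

/-- Going down carries the height bound up along integral extensions of normal domains. -/
theorem HeightAddTrdegGE.of_isIntegral {R R' : Type} [CommRing R] [CommRing R'] [Algebra k R]
    [Algebra k R'] [Algebra R R'] [IsScalarTower k R R'] [IsNoetherianRing R]
    [IsNoetherianRing R'] [IsDomain R']
    [FaithfulSMul R R'] [Algebra.IsIntegral R R'] [IsIntegrallyClosed R] {s : ℕ}
    (h : HeightAddTrdegGE k R s) : HeightAddTrdegGE k R' s := by
  intro P _ r hr
  refine (h (P.under R) r ((trdeg_quotient_under_le P).trans hr)).trans ?_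
  gcongr
  exact P.height_under_le_height

open Polynomial in
/-- A prime of `R[X]` that is extended from `R` has larger transcendence degree than its
contraction; any other prime has larger height. -/
theorem HeightAddTrdegGE.polynomial {R : Type} [CommRing R] [Algebra k R] [IsNoetherianRing R]
    {s : ℕ} (h : HeightAddTrdegGE k R s) : HeightAddTrdegGE k R[X] (s + 1) := by
  intro P _ r hr
  let q := P.under R
  have hqP : q.map C ≤ P := Ideal.map_comap_le
  have : (q.map C).IsPrime := Ideal.isPrime_map_C_of_isPrime (P := q)
  rcases hqP.eq_or_lt with heq | hlt
  · have h1 : Algebra.trdeg k (R ⧸ q) + 1 ≤ Algebra.trdeg k (R[X] ⧸ P) := by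
      refine le_trans ?_ (trdeg_add_le (S := R ⧸ q))
      gcongr
      have : Algebra.Transcendental (R ⧸ q) (R[X] ⧸ P) := by
        refine ⟨Ideal.Quotient.mk P X, ?_⟩
        rintro ⟨f, hf0, hf⟩
        apply hf0
        obtain ⟨f, rfl⟩ := Polynomial.map_surjective _ Ideal.Quotient.mk_surjective f
        have h1 : aeval (Ideal.Quotient.mk P X) (f.map (Ideal.Quotient.mk q)) =
            Ideal.Quotient.mk P f := by
          have h2 := aeval_map_algebraMap (R ⧸ q) (Ideal.Quotient.mk P X) f
          rw [Ideal.Quotient.algebraMap_eq] at h2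
          rw [h2]
          have h3 := aeval_algHom_apply (Ideal.Quotient.mkₐ R P) X f
          rw [aeval_X_left_apply] at h3
          exact h3
        rw [h1, Ideal.Quotient.eq_zero_iff_mem, ← heq, Ideal.mem_map_C_iff] at hf
        ext i
        rw [coeff_map, Ideal.Quotient.eq_zero_iff_mem.2 (hf i), coeff_zero]
      exact Cardinal.one_le_iff_pos.2 (trdeg_pos (R ⧸ q) (R[X] ⧸ P))
    cases r with
    | zero =>
      exfalso
      have := (le_add_left (le_refl (1 : Cardinal))).trans (h1.trans hr)
      simp at this
    | succ r =>
      have h2 : Algebra.trdeg k (R ⧸ q) ≤ r := by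
        have := h1.trans hr
        rw [Nat.cast_succ] at this
        exact (Cardinal.add_one_le_add_one_iff).1 this
      have h3 := h q r h2
      push_cast
      rw [← add_assoc]
      gcongr
      exact h3.trans (by gcongr; exact P.height_under_le_height)
  · have h1 := h q r ((trdeg_quotient_under_le P).trans hr)
    have h2 : q.height ≤ (q.map C).height := by
      have h3 := (q.map C).height_under_le_height (R := R)
      have h4 : (q.map C).under R = q := by
        ext a
        change C a ∈ q.map C ↔ a ∈ q
        rw [Ideal.mem_map_C_iff]
        refine ⟨fun h => by simpa using h 0, fun h i => ?_⟩
        rw [coeff_C]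
        split_ifs
        · exact h
        · exact q.zero_mem
      rwa [h4] at h3
    have h3 := Ideal.height_add_one_le_of_lt_of_isPrime hlt
    push_cast
    calc (s : ℕ∞) + 1 ≤ q.height + r + 1 := by gcongr
      _ ≤ (q.map C).height + 1 + r := by rw [add_right_comm]; gcongr
      _ ≤ P.height + r := by gcongr

theorem heightAddTrdegGE_mvPolynomial (k : Type) [Field k] (s : ℕ) :
    HeightAddTrdegGE k (MvPolynomial (Fin s) k) s := by
  induction s with
  | zero => exact fun P _ r _ => by simp
  | succ s ih => exact ih.polynomial.of_algEquiv (MvPolynomial.finSuccEquiv k s).symm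

/-- The height of a prime of an affine domain is at least the codimension, measured by
transcendence degrees. -/
theorem heightAddTrdegGE_of_finiteType {k R : Type} [Field k] [CommRing R] [IsDomain R]
    [Algebra k R] [Algebra.FiniteType k R] {s : ℕ} (hs : s ≤ Algebra.trdeg k R) :
    HeightAddTrdegGE k R s := by
  obtain ⟨m, g, hg, hint⟩ := exists_integral_inj_algHom_of_fg k R
  have : IsNoetherianRing R := Algebra.FiniteType.isNoetherianRing k R
  algebraize [g.toRingHom]
  have : IsScalarTower k (MvPolynomial (Fin m) k) R :=
    .of_algebraMap_eq fun c => (g.commutes c).symm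
  have : FaithfulSMul (MvPolynomial (Fin m) k) R :=
    (faithfulSMul_iff_algebraMap_injective _ _).2 hg
  have : Algebra.IsIntegral (MvPolynomial (Fin m) k) R := ⟨hint⟩
  have hm : Algebra.trdeg k R = m := by
    have h1 := trdeg_add_eq k (MvPolynomial (Fin m) k) (A := R)
    rw [trdeg_eq_zero (R := MvPolynomial (Fin m) k) (A := R), add_zero,
      MvPolynomial.trdeg_of_isDomain] at h1
    rw [← h1]
    simp
  have hsm : s ≤ m := by
    rw [hm] at hs
    exact_mod_cast hs
  intro P _ r hr
  exact le_trans (by exact_mod_cast hsm)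
    ((heightAddTrdegGE_mvPolynomial k m).of_isIntegral (R' := R) P r hr)

end dimension

/-! ### Heights of primes of toric rings -/

namespace EulerKoszul

variable {d n : ℕ} (A : Matrix (Fin d) (Fin n) ℤ)

instance : IsDomain (ToricRing A) :=
  have : UniqueSums (semigroup A) :=
    UniqueSums.of_injective_addHom (semigroup A).subtype.toAddHom Subtype.val_injective
      inferInstance
  have : NoZeroDivisors (AddMonoidAlgebra ℂ (semigroup A)) := inferInstance
  have : Nontrivial (AddMonoidAlgebra ℂ (semigroup A)) := inferInstance
  inferInstanceAs (IsDomain (AddMonoidAlgebra ℂ (semigroup A)))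

theorem monomial_zero : monomial A 0 = 1 := rfl

theorem monomial_sum {ι : Type*} (s : Finset ι) (h : ι → semigroup A) :
    monomial A (∑ i ∈ s, h i) = ∏ i ∈ s, monomial A (h i) := by
  classical
  induction s using Finset.induction_on with
  | empty => rw [Finset.sum_empty, Finset.prod_empty, monomial_zero]
  | insert i s hi ih => rw [Finset.sum_insert hi, Finset.prod_insert hi, ← ih, monomial_mul]

theorem monomial_nsmul (k : ℕ) (h : semigroup A) : monomial A (k • h) = monomial A h ^ k := by
  induction k with
  | zero => rw [zero_smul, pow_zero, monomial_zero]
  | succ k ih => rw [succ_nsmul, pow_succ, ← ih, monomial_mul]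

/-- The toric ring is generated by the monomials of the columns. -/
theorem mem_of_monomial_col_mem (T : Subalgebra ℂ (ToricRing A))
    (hT : ∀ j, monomial A (col A j) ∈ T) (y : ToricRing A) : y ∈ T := by
  have hmon : ∀ h : semigroup A, monomial A h ∈ T := by
    rintro ⟨h, hh⟩
    refine AddSubmonoid.closure_induction (motive := fun h hh => monomial A ⟨h, hh⟩ ∈ T)
      ?_ ?_ ?_ hh
    · rintro _ ⟨j, rfl⟩
      exact hT j
    · exact T.one_mem
    · intro h h' hh hh' h1 h2
      have := T.mul_mem h1 h2
      rwa [monomial_mul] at this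
  have hspan : Submodule.span ℂ (Set.range (monomialBasis A)) ≤ Subalgebra.toSubmodule T := by
    rw [Submodule.span_le]
    rintro _ ⟨h, rfl⟩
    exact hmon h
  exact hspan ((monomialBasis A).mem_span y)

instance : Algebra.FiniteType ℂ (ToricRing A) :=
  open Classical in
  ⟨⟨Finset.univ.image fun j => monomial A (col A j), eq_top_iff.2 fun y _ =>
    mem_of_monomial_col_mem A _ (fun j => Algebra.subset_adjoin (by simp)) y⟩⟩

theorem coe_nsmul_col_apply (k : ℕ) (j : Fin n) (l : Fin d) :
    (k • col A j).1 l = (k : ℤ) * A l j := by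
  rw [AddSubmonoidClass.coe_nsmul, Pi.smul_apply, nsmul_eq_mul]
  rfl

theorem coe_sum_nsmul_col_apply {κ : Type} [Fintype κ] (u : κ → ℕ) (a : κ → Fin n) (l : Fin d) :
    (∑ i, u i • col A (a i)).1 l = ∑ i, (u i : ℤ) * A l (a i) := by
  rw [AddSubmonoid.coe_finsetSum, Finset.sum_apply]
  exact Finset.sum_congr rfl fun i _ => coe_nsmul_col_apply A (u i) (a i) l

/-- The `j`-th column of `A`, as a rational vector. -/
def ratCol (j : Fin n) : Fin d → ℚ := fun i => A i j

/-- Monomials with linearly independent exponents are algebraically independent. -/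
theorem algebraicIndependent_monomial_col {κ : Type} [Fintype κ] (a : κ → Fin n)
    (ha : LinearIndependent ℚ fun i => ratCol A (a i)) :
    AlgebraicIndependent ℂ fun i => monomial A (col A (a i)) := by
  let φ : (κ →₀ ℕ) → semigroup A := fun u => ∑ i, u i • col A (a i)
  have hφ : Function.Injective φ := by
    intro u v huv
    have h1 : ∑ i, ((u i : ℚ) - v i) • ratCol A (a i) = 0 := by
      funext l
      have h2 := congrArg (fun h : semigroup A => ((h.1 l : ℤ) : ℚ)) huv
      simp only [φ, coe_sum_nsmul_col_apply] at h2
      push_cast at h2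
      simp only [Finset.sum_apply, Pi.smul_apply, Pi.zero_apply, smul_eq_mul, sub_mul,
        Finset.sum_sub_distrib, ratCol, sub_eq_zero]
      exact h2
    have h3 := Fintype.linearIndependent_iff.1 ha _ h1
    ext i
    have h4 := sub_eq_zero.1 (h3 i)
    exact_mod_cast h4
  have hind : LinearIndependent ℂ (fun u => monomialBasis A (φ u)) :=
    (monomialBasis A).linearIndependent.comp φ hφ
  rw [AlgebraicIndependent]
  have heq : ∀ f : MvPolynomial κ ℂ, MvPolynomial.aeval (fun i => monomial A (col A (a i))) f =
      Finsupp.linearCombination ℂ (fun u => monomialBasis A (φ u))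
        ((MvPolynomial.basisMonomials κ ℂ).repr f) := by
    refine LinearMap.congr_fun (f := (MvPolynomial.aeval
      fun i => monomial A (col A (a i))).toLinearMap) (g := (Finsupp.linearCombination ℂ
        (fun u => monomialBasis A (φ u))).comp
          (MvPolynomial.basisMonomials κ ℂ).repr.toLinearMap) ?_
    refine (MvPolynomial.basisMonomials κ ℂ).ext fun u => ?_
    rw [LinearMap.comp_apply, LinearEquiv.coe_coe, Module.Basis.repr_self,
      Finsupp.linearCombination_single, one_smul, monomialBasis_apply, monomial_sum,
      MvPolynomial.coe_basisMonomials, AlgHom.toLinearMap_apply, MvPolynomial.aeval_monomial,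
      map_one, one_mul, Finsupp.prod_fintype _ _ fun i => pow_zero _]
    exact Finset.prod_congr rfl fun i _ => (monomial_nsmul A (u i) (col A (a i))).symm
  intro f g hfg
  rw [heq, heq] at hfg
  exact (MvPolynomial.basisMonomials κ ℂ).repr.injective (hind hfg)

variable {A}

/-- The rational span of the columns is everything. -/
theorem span_ratCol_eq_top
    (hspan : AddSubgroup.closure (Set.range fun (j : Fin n) (i : Fin d) => A i j) = ⊤) :
    Submodule.span ℚ (Set.range (ratCol A)) = ⊤ := by
  have hint : ∀ h : Fin d → ℤ, (fun i => (h i : ℚ)) ∈ Submodule.span ℚ (Set.range (ratCol A)) := by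
    intro h
    have hh : h ∈ AddSubgroup.closure (Set.range fun (j : Fin n) (i : Fin d) => A i j) :=
      hspan ▸ AddSubgroup.mem_top h
    induction hh using AddSubgroup.closure_induction with
    | mem h hh =>
      obtain ⟨j, rfl⟩ := hh
      exact Submodule.subset_span ⟨j, rfl⟩
    | zero =>
      convert! Submodule.zero_mem _ using 1
    | add h h' _ _ h1 h2 =>
      convert! Submodule.add_mem _ h1 h2 using 1
      exact funext fun i => Int.cast_add _ _
    | neg h _ h1 =>
      convert! Submodule.neg_mem _ h1 using 1
  refine eq_top_iff.2 fun v _ => ?_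
  rw [pi_eq_sum_univ v]
  refine Submodule.sum_mem _ fun i _ => Submodule.smul_mem _ _ ?_
  convert! hint (fun j => if i = j then 1 else 0) using 1
  funext j
  push_cast
  rfl

theorem le_trdeg_toricRing
    (hspan : AddSubgroup.closure (Set.range fun (j : Fin n) (i : Fin d) => A i j) = ⊤) :
    (d : Cardinal) ≤ Algebra.trdeg ℂ (ToricRing A) := by
  obtain ⟨κ, a, hinj, hsp, hli⟩ := exists_linearIndependent' ℚ (ratCol A)
  have : Fintype κ := Fintype.ofInjective a hinj
  rw [span_ratCol_eq_top hspan] at hsp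
  have hcard := Module.finrank_eq_card_basis (Module.Basis.mk hli hsp.ge)
  rw [Module.finrank_fin_fun] at hcard
  have h := (algebraicIndependent_monomial_col A a hli).cardinalMk_le_trdeg
  rwa [Cardinal.mk_fintype, ← hcard] at h

variable (A) in
/-- If the exponent of the monomial `t^{a_k}` is a rational combination of those of monomials that
are nonzero modulo the prime `P`, then `t^{a_k}` is algebraic over them modulo `P`. -/
theorem isAlgebraic_monomial_col (P : Ideal (ToricRing A)) [P.IsPrime] {κ : Type} [Fintype κ]
    (a : κ → Fin n) (ha : ∀ i, monomial A (col A (a i)) ∉ P) (k : Fin n)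
    (hk : ratCol A k ∈ Submodule.span ℚ (Set.range fun i => ratCol A (a i))) :
    IsAlgebraic
      (Algebra.adjoin ℂ (Set.range fun i => Ideal.Quotient.mk P (monomial A (col A (a i)))))
      (Ideal.Quotient.mk P (monomial A (col A k))) := by
  obtain ⟨c, hc⟩ := (Submodule.mem_span_range_iff_exists_fun ℚ).1 hk
  obtain ⟨b, hb⟩ := IsLocalization.exist_integer_multiples_of_finite (nonZeroDivisors ℤ) c
  have hb0 : (b : ℤ) ≠ 0 := nonZeroDivisors.coe_ne_zero b
  choose z hz using hb
  -- Multiplying by `b` once more makes the coefficient of `a_k` positive.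
  let N : ℕ := (b : ℤ).natAbs ^ 2
  have hN : (N : ℤ) = b * b := by
    simp [N, sq]
  let p : semigroup A := ∑ i, (b * z i : ℤ).toNat • col A (a i)
  let m : semigroup A := ∑ i, (-(b * z i) : ℤ).toNat • col A (a i)
  have hrel : m + N • col A k = p := by
    refine Subtype.ext (funext fun l => ?_)
    have h1 := congrFun hc l
    simp only [Finset.sum_apply, Pi.smul_apply, smul_eq_mul, ratCol] at h1
    have h2 : (b : ℤ) * A l k = ∑ i, z i * A l (a i) := by
      have h3 : ((b : ℤ) : ℚ) * A l k = ∑ i, (z i : ℚ) * A l (a i) := by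
        rw [← h1, Finset.mul_sum]
        refine Finset.sum_congr rfl fun i _ => ?_
        have h4 := hz i
        rw [zsmul_eq_mul] at h4
        rw [← mul_assoc, ← h4]
        rfl
      exact_mod_cast h3
    have h5 : ∀ i, ((-(b * z i) : ℤ).toNat : ℤ) * A l (a i) + b * (z i * A l (a i)) =
        ((b * z i : ℤ).toNat : ℤ) * A l (a i) := fun i => by
      have := Int.toNat_sub_toNat_neg (b * z i)
      linear_combination (-A l (a i)) * this
    rw [AddSubmonoid.coe_add, Pi.add_apply, coe_sum_nsmul_col_apply, coe_sum_nsmul_col_apply,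
      coe_nsmul_col_apply, hN, mul_assoc, h2, Finset.mul_sum, ← Finset.sum_add_distrib]
    exact Finset.sum_congr rfl fun i _ => h5 i
  let R := Algebra.adjoin ℂ (Set.range fun i => Ideal.Quotient.mk P (monomial A (col A (a i))))
  have hgen : ∀ i, Ideal.Quotient.mk P (monomial A (col A (a i))) ∈ R := fun i =>
    Algebra.subset_adjoin ⟨i, rfl⟩
  have hmem : ∀ u : κ → ℕ, Ideal.Quotient.mk P (monomial A (∑ i, u i • col A (a i))) ∈ R := by
    intro u
    rw [monomial_sum, map_prod]
    refine R.prod_mem fun i _ => ?_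
    rw [monomial_nsmul, map_pow]
    exact R.pow_mem (hgen i) _
  have hm0 : Ideal.Quotient.mk P (monomial A m) ≠ 0 := by
    rw [monomial_sum, map_prod, Finset.prod_ne_zero_iff]
    intro i _
    rw [monomial_nsmul, map_pow]
    exact pow_ne_zero _ fun h => ha i (Ideal.Quotient.eq_zero_iff_mem.1 h)
  let m' : R := ⟨_, hmem fun i => (-(b * z i) : ℤ).toNat⟩
  let p' : R := ⟨_, hmem fun i => (b * z i : ℤ).toNat⟩
  have hm' : m' ≠ 0 := fun h => hm0 (congrArg Subtype.val h)
  have hN0 : N ≠ 0 := by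
    intro h
    rw [h] at hN
    exact hb0 (mul_self_eq_zero.1 hN.symm)
  refine ⟨Polynomial.C m' * Polynomial.X ^ N - Polynomial.C p', fun h => hm' ?_, ?_⟩
  · have := congrArg (Polynomial.coeff · N) h
    simpa [Polynomial.coeff_C, hN0] using this
  · have h1 : Ideal.Quotient.mk P (monomial A m) * Ideal.Quotient.mk P (monomial A (col A k)) ^ N =
        Ideal.Quotient.mk P (monomial A p) := by
      rw [← map_pow, ← map_mul, ← monomial_nsmul, monomial_mul, hrel]
    rw [map_sub, map_mul, map_pow, Polynomial.aeval_C, Polynomial.aeval_C, Polynomial.aeval_X]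
    exact sub_eq_zero.2 h1

variable (A) in
theorem trdeg_quotient_le (P : Ideal (ToricRing A)) [P.IsPrime] {κ : Type} [Fintype κ]
    (a : κ → Fin n) (ha : ∀ i, monomial A (col A (a i)) ∉ P)
    (hsp : ∀ k, monomial A (col A k) ∉ P →
      ratCol A k ∈ Submodule.span ℚ (Set.range fun i => ratCol A (a i))) :
    Algebra.trdeg ℂ (ToricRing A ⧸ P) ≤ Fintype.card κ := by
  let v : κ → ToricRing A ⧸ P := fun i => Ideal.Quotient.mk P (monomial A (col A (a i)))
  have halg : Algebra.IsAlgebraic (Algebra.adjoin ℂ (Set.range v)) (ToricRing A ⧸ P) := by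
    let T : Subalgebra ℂ (ToricRing A) := ((Subalgebra.algebraicClosure
      (Algebra.adjoin ℂ (Set.range v)) (ToricRing A ⧸ P)).restrictScalars ℂ).comap
        (Ideal.Quotient.mkₐ ℂ P)
    have hT : ∀ y, y ∈ T := mem_of_monomial_col_mem A T fun k => by
      by_cases hk : monomial A (col A k) ∈ P
      · change IsAlgebraic _ (Ideal.Quotient.mk P (monomial A (col A k)))
        rw [Ideal.Quotient.eq_zero_iff_mem.2 hk]
        exact isAlgebraic_zero
      · exact isAlgebraic_monomial_col A P a ha k (hsp k hk)
    refine ⟨fun y => ?_⟩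
    obtain ⟨y, rfl⟩ := Ideal.Quotient.mk_surjective y
    exact hT y
  refine (Algebra.IsAlgebraic.trdeg_le_cardinalMk ℂ (Set.range v)).trans
    (Cardinal.mk_range_le.trans ?_)
  simp

/-- The height of a prime `P` of the toric ring is at least `d - r`, where `r` is the rank of the
columns whose monomials are not in `P`. -/
theorem le_height_add_card
    (hspan : AddSubgroup.closure (Set.range fun (j : Fin n) (i : Fin d) => A i j) = ⊤)
    (P : Ideal (ToricRing A)) [P.IsPrime] {κ : Type} [Fintype κ]
    (a : κ → Fin n) (ha : ∀ i, monomial A (col A (a i)) ∉ P)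
    (hsp : ∀ k, monomial A (col A k) ∉ P →
      ratCol A k ∈ Submodule.span ℚ (Set.range fun i => ratCol A (a i))) :
    (d : ℕ∞) ≤ P.height + Fintype.card κ :=
  heightAddTrdegGE_of_finiteType (le_trdeg_toricRing hspan) P _ (trdeg_quotient_le A P a ha hsp)

end EulerKoszul

/-! ### Regular sequences of linear forms -/

section regular

open MvPolynomial RingTheory.Sequence

variable {R ι : Type} [CommRing R]

theorem isWeaklyRegular_map_ringEquiv {R R' : Type*} [CommRing R] [CommRing R'] (e : R ≃+* R')
    (rs : List R) : IsWeaklyRegular R rs ↔ IsWeaklyRegular R' (rs.map e) :=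
  e.toAddEquiv.isWeaklyRegular_congr <| List.forall₂_map_right_iff.mpr <|
    List.forall₂_same.mpr fun r _ x => map_mul e r x

/-- Distinct variables form a weakly regular sequence. -/
theorem isWeaklyRegular_map_X {L : List ι} (hL : L.Nodup) :
    IsWeaklyRegular (MvPolynomial ι R) (L.map (X (R := R))) := by
  classical
  refine ⟨fun i hi => ?_⟩
  have hi' : i < L.length := by simpa using hi
  have hI : (Ideal.ofList ((L.map (X (R := R))).take i) • ⊤ : Ideal (MvPolynomial ι R)) =
      Ideal.span (X '' {j | j ∈ L.take i}) := by
    rw [smul_eq_mul, Ideal.mul_top, Ideal.ofList, ← List.map_take]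
    congr 1
    ext p
    simp only [Set.mem_ofPred_eq, List.mem_map, Set.mem_image]
  rw [isSMulRegular_quotient_iff_mem_of_smul_mem, hI, List.getElem_map]
  intro p hp
  rw [mem_ideal_span_X_image] at hp ⊢
  intro m hm
  obtain ⟨j, hj, hmj⟩ := hp (m + Finsupp.single L[i] 1) (by
    rw [mem_support_iff, smul_eq_mul, mul_comm, coeff_mul_X]
    exact mem_support_iff.1 hm)
  refine ⟨j, hj, ?_⟩
  have hne : L[i] ≠ j := by
    rintro rfl
    obtain ⟨k, hk, hk'⟩ := List.mem_take_iff_getElem.1 hj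
    have := (hL.getElem_inj_iff).1 hk'
    omega
  simpa [Finsupp.single_apply, hne] using hmj

/-- Linear forms in echelon form, with respect to a set `J` of variables and with invertible
pivots, form a weakly regular sequence: a linear change of coordinates carries them to the
variables in `J`. -/
theorem isWeaklyRegular_linearForms [Fintype ι] [DecidableEq ι] (J : Finset ι) (c : ι → ι → R)
    (hu : ∀ j ∈ J, IsUnit (c j j)) (h0 : ∀ j ∈ J, ∀ k ∈ J, j ≠ k → c j k = 0) :
    IsWeaklyRegular (MvPolynomial ι R) (J.toList.map fun j => ∑ k, C (c j k) * X k) := by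
  let g : ι → MvPolynomial ι R := fun j => ∑ k ∈ Jᶜ, C (c j k) * X k
  let σ : MvPolynomial ι R →ₐ[R] MvPolynomial ι R :=
    aeval fun j => if j ∈ J then C (c j j) * X j + g j else X j
  let τ : MvPolynomial ι R →ₐ[R] MvPolynomial ι R :=
    aeval fun j => if j ∈ J then C (Ring.inverse (c j j)) * (X j - g j) else X j
  have hσX : ∀ j, σ (X j) = if j ∈ J then C (c j j) * X j + g j else X j := fun j => aeval_X _ j
  have hτX : ∀ j, τ (X j) = if j ∈ J then C (Ring.inverse (c j j)) * (X j - g j) else X j :=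
    fun j => aeval_X _ j
  have hσC : ∀ r, σ (C r) = C r := fun r => σ.commutes r
  have hτC : ∀ r, τ (C r) = C r := fun r => τ.commutes r
  have hσg : ∀ j, σ (g j) = g j := fun j => by
    rw [map_sum]
    refine Finset.sum_congr rfl fun k hk => ?_
    rw [map_mul, hσC, hσX, if_neg (Finset.mem_compl.1 hk)]
  have hτg : ∀ j, τ (g j) = g j := fun j => by
    rw [map_sum]
    refine Finset.sum_congr rfl fun k hk => ?_
    rw [map_mul, hτC, hτX, if_neg (Finset.mem_compl.1 hk)]
  have hcw : ∀ j ∈ J, (C (c j j) * C (Ring.inverse (c j j)) : MvPolynomial ι R) = 1 :=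
    fun j hj => by rw [← C_mul, Ring.mul_inverse_cancel _ (hu j hj), C_1]
  let e : MvPolynomial ι R ≃ₐ[R] MvPolynomial ι R := AlgEquiv.ofAlgHom σ τ
    (MvPolynomial.algHom_ext fun j => by
      rw [AlgHom.comp_apply, hτX, AlgHom.id_apply]
      split_ifs with hj
      · rw [map_mul, map_sub, hσC, hσg, hσX, if_pos hj, add_sub_cancel_right]
        linear_combination X j * hcw j hj
      · rw [hσX, if_neg hj])
    (MvPolynomial.algHom_ext fun j => by
      rw [AlgHom.comp_apply, hσX, AlgHom.id_apply]
      split_ifs with hj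
      · rw [map_add, map_mul, hτC, hτg, hτX, if_pos hj]
        linear_combination (X j - g j) * hcw j hj
      · rw [hτX, if_neg hj])
  have h := (isWeaklyRegular_map_ringEquiv e.toRingEquiv _).1
    (isWeaklyRegular_map_X (R := R) J.nodup_toList)
  rw [List.map_map] at h
  convert! h using 1
  refine List.map_congr_left fun j hj => ?_
  have hj' := Finset.mem_toList.1 hj
  change _ = σ (X j)
  rw [hσX, if_pos hj', ← Finset.sum_add_sum_compl J, Finset.sum_eq_single j]
  · intro k hk hkj
    rw [h0 j hj' k hk hkj.symm, C_0, zero_mul]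
  · exact fun h => absurd hj' h

/-- A weakly regular sequence of the coefficient ring, followed by linear forms in echelon form. -/
theorem isWeaklyRegular_map_C_append_linearForms [Fintype ι] [DecidableEq ι] (J : Finset ι)
    (c : ι → ι → R) (hu : ∀ j ∈ J, IsUnit (c j j))
    (h0 : ∀ j ∈ J, ∀ k ∈ J, j ≠ k → c j k = 0) {f : List R} (hf : IsWeaklyRegular R f) :
    IsWeaklyRegular (MvPolynomial ι R)
      (f.map C ++ J.toList.map fun j => ∑ k, C (c j k) * X k) := by
  rw [isWeaklyRegular_append_iff]
  refine ⟨hf.of_flat (S := MvPolynomial ι R), ?_⟩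
  have hI : (Ideal.ofList (f.map (C (σ := ι))) • ⊤ : Ideal (MvPolynomial ι R)) =
      (Ideal.ofList f).map C := by
    rw [smul_eq_mul, Ideal.mul_top, Ideal.map_ofList]
  rw [(Submodule.quotEquivOfEq _ _ hI).isWeaklyRegular_congr,
    ← isWeaklyRegular_map_algebraMap_iff (MvPolynomial ι R ⧸ (Ideal.ofList f).map C)]
  let e := quotientEquivQuotientMvPolynomial (σ := ι) (Ideal.ofList f)
  have h := (isWeaklyRegular_map_ringEquiv e.toRingEquiv _).1
    (isWeaklyRegular_linearForms J (fun j k => Ideal.Quotient.mk (Ideal.ofList f) (c j k))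
      (fun j hj => (hu j hj).map _) (fun j hj k hk hjk => by rw [h0 j hj k hk hjk, map_zero]))
  rw [List.map_map] at h ⊢
  convert! h using 1
  refine List.map_congr_left fun j _ => ?_
  rw [Function.comp_apply, Function.comp_apply, Ideal.Quotient.algebraMap_eq]
  change _ = e _
  rw [map_sum, map_sum]
  refine Finset.sum_congr rfl fun k _ => ?_
  have hC : e (C (Ideal.Quotient.mk _ (c j k))) = Ideal.Quotient.mk _ (C (c j k)) :=
    eval₂Hom_C _ _ _
  have hX : e (X k) = Ideal.Quotient.mk _ (X k) := eval₂Hom_X' _ _ _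
  rw [map_mul, map_mul, hC, hX]

end regular

/-! ### Exactness of the Koszul complex of the symbols -/

/-- A linearly independent family of vectors has a dual family of functionals; they are given by
their coefficient vectors. -/
theorem exists_dual_of_linearIndepOn {K ι : Type*} [Field K] {d : ℕ} {v : ι → Fin d → K}
    {J : Set ι} (h : LinearIndepOn K v J) [DecidableEq ι] :
    ∃ c : ι → Fin d → K, ∀ j ∈ J, ∀ k ∈ J, ∑ l, c j l * v k l = if j = k then 1 else 0 := by
  have h' : LinearIndependent K fun j : J => v j := h
  have : ∀ j : ι, ∃ c : Fin d → K, j ∈ J → ∀ k ∈ J, ∑ l, c l * v k l = if j = k then 1 else 0 := by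
    intro j
    by_cases hj : j ∈ J
    · obtain ⟨g, hg⟩ := LinearMap.exists_extend ((Finsupp.lapply (⟨j, hj⟩ : J)).comp
        h'.repr)
      refine ⟨fun l => g (Pi.single l 1), fun _ k hk => ?_⟩
      have h1 : g (v k) = ∑ l, g (Pi.single l 1) * v k l := by
        conv_lhs => rw [pi_eq_sum_univ' (v k), map_sum]
        refine Finset.sum_congr rfl fun l _ => ?_
        rw [map_smul, smul_eq_mul, mul_comm]
      have h2 := LinearMap.congr_fun hg ⟨v k, Submodule.subset_span ⟨⟨k, hk⟩, rfl⟩⟩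
      change g (v k) = h'.repr _ _ at h2
      rw [← h1, h2, h'.repr_eq_single ⟨k, hk⟩ _ rfl, Finsupp.single_apply]
      simp only [Subtype.mk.injEq, eq_comm]
    · exact ⟨0, fun h => absurd h hj⟩
  choose c hc using this
  exact ⟨c, fun j hj k hk => hc j hj k hk⟩

namespace EulerKoszul

open MvPolynomial

variable {d n : ℕ} {A : Matrix (Fin d) (Fin n) ℤ}

/-- The Koszul complex of the symbols of the Euler operators is exact in positive degrees. At a
prime `P` of the toric ring, let `r` be the rank of the columns whose monomials are invertible
locally at `P`. Combinations of the symbols provide `r` linear forms in echelon form, and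
the Cohen–Macaulay property provides a regular sequence in `P` of length at least `d - r`. -/
theorem exactAtSucc_symbol
    (hspan : AddSubgroup.closure (Set.range fun (j : Fin n) (i : Fin d) => A i j) = ⊤)
    (hCM : IsCohenMacaulayRing (ToricRing A)) (q : ℕ) :
    Koszul.ExactAtSucc (Koszul.mulEnd (symbol A) (MvPolynomial (Fin n) (ToricRing A))) q := by
  have := hCM.1
  refine Koszul.exactAtSucc_mvPolynomial (symbol A) (fun P _ => ?_) q
  let S' := Localization.AtPrime P
  obtain ⟨-, f, hfmem, hfreg, hflen⟩ := hCM.2 P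
  obtain ⟨J, hJF, -, hJspan, hJ⟩ := exists_linearIndepOn_extension
    (linearIndepOn_empty ℚ (ratCol A)) (Set.empty_subset {j | monomial A (col A j) ∉ P})
  classical
  lift J to Finset (Fin n) using J.toFinite
  obtain ⟨c, hc⟩ := exists_dual_of_linearIndepOn hJ
  let τ : Fin n → S' := fun j => algebraMap (ToricRing A) S' (monomial A (col A j))
  let c' : Fin n → Fin n → S' := fun j k => algebraMap ℂ S' (∑ l, c j l * ratCol A k l : ℚ) * τ k
  have hlen : d ≤ f.length + J.card := by
    have h1 := le_height_add_card hspan P (κ := J) (fun j => j.1) (fun j => hJF j.2)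
      (fun k hk => by
        have := hJspan ⟨k, hk, rfl⟩
        rwa [Set.image_eq_range] at this)
    rw [IsLocalization.AtPrime.ringKrullDim_eq_height P] at hflen
    rw [← WithBot.coe_inj.1 (show ((f.length : ℕ∞) : WithBot ℕ∞) = _ from hflen),
      Fintype.card_coe] at h1
    exact_mod_cast h1
  refine ⟨f.map C ++ J.toList.map fun j => ∑ k, C (c' j k) * X k,
    isWeaklyRegular_map_C_append_linearForms J c' ?_ ?_ hfreg.toIsWeaklyRegular, ?_, ?_⟩
  · intro j hj
    have h1 : IsUnit (τ j) := IsLocalization.map_units S' (⟨_, hJF hj⟩ : P.primeCompl)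
    simpa only [c', hc j hj j hj, if_true, Rat.cast_one, map_one, one_mul] using h1
  · intro j hj k hk hjk
    simp only [c', hc j hj k hk, if_neg hjk, Rat.cast_zero, map_zero, zero_mul]
  · simpa using hlen
  · intro r hr
    rw [List.mem_append, List.mem_map, List.mem_map] at hr
    rcases hr with ⟨m, hm, rfl⟩ | ⟨j, -, rfl⟩
    · exact Or.inl ⟨m, hfmem m hm, rfl⟩
    · right
      -- The form is the combination of the symbols with coefficients the dual functional `c j`.
      have h1 : ∑ k, C (c' j k) * X k =
          ∑ i, C (algebraMap ℂ S' (c j i : ℚ)) *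
            map (algebraMap (ToricRing A) S') (symbol A i) := by
        have h2 : ∀ i, map (algebraMap (ToricRing A) S') (symbol A i) =
            ∑ k, C ((A i k : S') * τ k) * X k := by
          intro i
          rw [symbol, map_sum]
          refine Finset.sum_congr rfl fun k _ => ?_
          rw [map_monomial, ← C_mul_X_eq_monomial, map_zsmul, zsmul_eq_mul]
        simp only [h2, Finset.mul_sum]
        rw [Finset.sum_comm]
        refine Finset.sum_congr rfl fun k _ => ?_
        simp only [← mul_assoc, ← C_mul]
        rw [← Finset.sum_mul, ← map_sum, ← Finset.sum_mul]
        refine congrArg (fun s => C (s * τ k) * X k) ?_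
        rw [Rat.cast_sum, map_sum]
        refine Finset.sum_congr rfl fun i _ => ?_
        rw [ratCol, Rat.cast_mul, Rat.cast_intCast, map_mul, map_intCast]
      rw [h1]
      exact Ideal.sum_mem _ fun i _ => Ideal.mul_mem_left _ _ (Ideal.subset_span ⟨i, rfl⟩)

end EulerKoszul

theorem mainTheorem1 (d n : ℕ) (A : Matrix (Fin d) (Fin n) ℤ)
    (hpos : ∀ h ∈ EulerKoszul.semigroup A, -h ∈ EulerKoszul.semigroup A → h = 0)
    (hspan : AddSubgroup.closure (Set.range fun (j : Fin n) (i : Fin d) => A i j) = ⊤)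
    (hCM : IsCohenMacaulayRing (EulerKoszul.ToricRing A))
    (β : Fin d → ℂ) (p : ℕ) (hp : 0 < p) :
    (EulerKoszul.eulerKoszulComplex A β).ExactAt p := by
  obtain ⟨q, rfl⟩ : ∃ q, p = q + 1 := ⟨p - 1, by omega⟩
  exact Koszul.exactAt_complex _
    (EulerKoszul.exactAtSucc_eulerEnd A (EulerKoszul.exactAtSucc_symbol hspan hCM q) β)
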